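/- Let $\alpha$ be an infinite set (for instance an infinite ordinal). A cylindric algebra of dimension $\alpha$ is an algebra $\mathfrak A=\langle A,+,-,c_i,d_{ij}\rangle_{i,j\in\alpha}$ such that $\langle A,+,-\rangle$ is a Boolean algebra (possibly with one element) and, for all distinct $i,j,k\in\alpha$ and all $x,y\in A$: $c_ic_jx=c_jc_ix$, $x\le c_ix=c_ic_ix$, $c_i(x+y)=c_ix+c_iy$, $c_i(-c_ix)=-c_ix$, $d_{ii}=1$, $d_{ij}=d_{ji}$, $c_j(d_{ij}\cdot d_{jk})=d_{ik}$, $c_id_{ij}=1$, $d_{ij}\cdot c_i(d_{ij}\cdot x)=d_{ij}\cdot x$. Let $\mathrm{CA}_\alpha$ be the class of these algebras. Equations are in the language $+,-,c_i,d_{ij}$ $(i,j\in\alpha)$ with countably many variables, and $\mathrm{Eq}(\mathfrak A)$ is the set of all equations valid in $\mathfrak A$. Define the following classes. * $\mathrm{RCA}_\alpha$ (representable algebras): the algebras isomorphic to a subalgebra of an algebra $\langle \mathcal P(V),\cup,\ V\setminus(\cdot),\ C_i^V,\ D_{ij}^V\rangle_{i,j\in\alpha}$, where $V\subseteq{}^\alpha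 U$ is a union of pairwise disjoint sets of the form ${}^\alpha W$ $(W\subseteq U)$, $C^V_iX$ is the set of all $t\in V$ that differ from some $s\in X$ at most at the index $i$, and $D^V_{ij}=\{s\in V: s_i=s_j\}$. * $\mathrm{Lf}_\alpha$ (locally finite dimensional): those $\mathfrak A\in\mathrm{CA}_\alpha$ such that for every $x\in A$ the set $\{i\in\alpha: c_ix\ne x\}$ is finite. * $\mathrm{Edc}_\alpha$ (endo-dc): those $\mathfrak A\in\mathrm{CA}_\alpha$ such that for every finite $\Gamma\subseteq\alpha$ and every nonzero $x\in A$ there are $\kappa\in\alpha\setminus\Gamma$ and an endomorphism $h$ of the reduct $\langle A,+,-,c_i,d_{ij}\rangle_{i,j\in\Gamma}$ with $h(x)\neq 0$ and $c_\kappa h(a)=h(a)$ for all $a\in A$. * $\mathrm{Sy}_\alpha$ (symmetric): those $\mathfrak A\in\mathrm{CA}_\alpha$ such that for every equation $e$ and every permutation $\rho$ of $\alpha$, if $e$ is valid in $\mathfrak A$ then so is the equation $\rho(e)$ obtained from $e$ by replacing each index $i$ with $\rho(i)$. * $\mathrm{Ret}_\alpha$ (inductive): those $\mathfrak A\in\mathrm{CA}_\alpha$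 such that for every equation $e(x_1,\dots,x_n)$ and every $i\in\alpha$ that does not occur as an index of an operation in $e$, if $e(c_ix_1,\dots,c_ix_n)$ is valid in $\mathfrak A$ then $e(x_1,\dots,x_n)$ is valid in $\mathfrak A$. Then: (i) $\mathrm{Edc}_\alpha\subsetneq\mathrm{Ret}_\alpha\subsetneq\mathrm{Sy}_\alpha\cap\mathrm{RCA}_\alpha$; that is, each endo-dc algebra is inductive, each inductive algebra is symmetric and representable, and both inclusions are proper. (ii) A cylindric algebra $\mathfrak A\in\mathrm{CA}_\alpha$ is inductive if and only if $\mathrm{Eq}(\mathfrak A)=\mathrm{Eq}(\mathfrak B)$ for some $\mathfrak B\in\mathrm{Lf}_\alpha$. -/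

import Mathlib

universe u

namespace CylAlg

/-- An algebra `⟨A, +, -, c i, d i j⟩` of the similarity type of `ι`-dimensional cylindric algebras
whose `+, -` part is a Boolean algebra (`+` is `⊔`, `-` is `ᶜ`, `·` is `⊓`). No law is imposed on
the cylindrifications `c i` and the diagonal constants `d i j` here. -/
structure CylStruct (ι : Type u) where
  carrier : Type u
  [boolean : BooleanAlgebra carrier]
  c : ι → carrier → carrier
  d : ι → ι → carrier

instance {ι : Type u} (A : CylStruct ι) : BooleanAlgebra A.carrier := A.boolean

section Classes

variable (ι : Type u)

/-- The class of all cylindric algebras of dimension `ι`. -/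
def CA : Set (CylStruct ι) :=
  {A | (∀ i j x, A.c i (A.c j x) = A.c j (A.c i x)) ∧
    (∀ i x, x ≤ A.c i x) ∧
    (∀ i x, A.c i (A.c i x) = A.c i x) ∧
    (∀ i x y, A.c i (x ⊔ y) = A.c i x ⊔ A.c i y) ∧
    (∀ i x, A.c i (A.c i x)ᶜ = (A.c i x)ᶜ) ∧
    (∀ i, A.d i i = ⊤) ∧
    (∀ i j, A.d i j = A.d j i) ∧
    (∀ i j k, i ≠ j → i ≠ k → j ≠ k → A.c j (A.d i j ⊓ A.d j k) = A.d i k) ∧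
    (∀ i j, i ≠ j → A.c i (A.d i j) = ⊤) ∧
    (∀ i j x, i ≠ j → A.d i j ⊓ A.c i (A.d i j ⊓ x) = A.d i j ⊓ x)}

end Classes

section Basic

variable {ι : Type u}

/-- `h` is a homomorphism between the `Γ`-reducts `⟨A, +, -, c i, d i j⟩`, `i, j ∈ Γ`. -/
structure IsReductHom (Γ : Set ι) (A B : CylStruct ι) (h : A.carrier → B.carrier) : Prop where
  map_sup : ∀ x y, h (x ⊔ y) = h x ⊔ h y
  map_compl : ∀ x, h xᶜ = (h x)ᶜ
  map_c : ∀ i ∈ Γ, ∀ x, h (A.c i x) = B.c i (h x)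
  map_d : ∀ i ∈ Γ, ∀ j ∈ Γ, h (A.d i j) = B.d i j

/-- The full cylindric set algebra with unit `V`, a set of `ι`-termed sequences: its elements are
the subsets of `V`, and `c i X` consists of the members of `V` that arise from a member of `X` by
changing its value at `i`. -/
def fullSetAlgebra {U : Type u} (V : Set (ι → U)) : CylStruct ι where
  carrier := Set V
  c := fun i X => {t | ∃ s ∈ X, ∀ j, j ≠ i → t.1 j = s.1 j}
  d := fun i j => {s | s.1 i = s.1 j}

/-- The `ι`-dimensional (Cartesian) space over `W`: all sequences with values in `W`. -/
def space (ι : Type u) {U : Type u} (W : Set U) : Set (ι → U) := {s | ∀ i, s i ∈ W}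

end Basic

/-- The class of representable (geometric) algebras of dimension `ι`, for infinite `ι`: the
algebras isomorphic to a subalgebra of a full cylindric set algebra whose unit is a union of
pairwise disjoint `ι`-dimensional spaces. -/
def RCA (ι : Type u) : Set (CylStruct ι) :=
  {A | ∃ (U : Type u) (S : Set (Set U)), S.PairwiseDisjoint (space ι) ∧
    ∃ h : A.carrier → (fullSetAlgebra (⋃ W ∈ S, space ι W)).carrier,
      IsReductHom Set.univ A (fullSetAlgebra (⋃ W ∈ S, space ι W)) h ∧ Function.Injective h}

/-- The class of locally finite dimensional cylindric algebras: each element is a fixed point of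
all but finitely many cylindrifications. -/
def Lf (ι : Type u) : Set (CylStruct ι) :=
  {A | A ∈ CA ι ∧ ∀ x : A.carrier, {i | A.c i x ≠ x}.Finite}

/-- The class of endo-dimension-complemented (endo-dc) cylindric algebras. -/
def Edc (ι : Type u) : Set (CylStruct ι) :=
  {A | A ∈ CA ι ∧ ∀ Γ : Set ι, Γ.Finite → ∀ x : A.carrier, x ≠ ⊥ →
    ∃ κ, κ ∉ Γ ∧ ∃ h : A.carrier → A.carrier, IsReductHom Γ A A h ∧ h x ≠ ⊥ ∧
      ∀ a, A.c κ (h a) = h a}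

/-- Terms of the language of `ι`-dimensional cylindric algebras, over countably many variables. -/
inductive CTerm (ι : Type u) : Type u
  | var : ℕ → CTerm ι
  | add : CTerm ι → CTerm ι → CTerm ι
  | neg : CTerm ι → CTerm ι
  | cyl : ι → CTerm ι → CTerm ι
  | diag : ι → ι → CTerm ι

namespace CTerm

variable {ι : Type u}

/-- The value of a term under an evaluation `v` of the variables. -/
def eval (A : CylStruct ι) (v : ℕ → A.carrier) : CTerm ι → A.carrier
  | var n => v n
  | add s t => eval A v s ⊔ eval A v t
  | neg t => (eval A v t)ᶜ
  | cyl i t => A.c i (eval A v t)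
  | diag i j => A.d i j

/-- Renaming the indices of the operations of a term according to `ρ`. -/
def rename (ρ : ι → ι) : CTerm ι → CTerm ι
  | var n => var n
  | add s t => add (rename ρ s) (rename ρ t)
  | neg t => neg (rename ρ t)
  | cyl i t => cyl (ρ i) (rename ρ t)
  | diag i j => diag (ρ i) (ρ j)

/-- The set of indices of the operations occurring in a term. -/
def ind : CTerm ι → Set ι
  | var _ => ∅
  | add s t => ind s ∪ ind t
  | neg t => ind t
  | cyl i t => insert i (ind t)
  | diag i j => {i, j}

/-- `t(c i x₁, …, c i xₙ)`: every variable `x` is replaced by `c i x`. -/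
def cylVars (i : ι) : CTerm ι → CTerm ι
  | var n => cyl i (var n)
  | add s t => add (cylVars i s) (cylVars i t)
  | neg t => neg (cylVars i t)
  | cyl j t => cyl j (cylVars i t)
  | diag j k => diag j k

end CTerm

/-- An equation `lhs = rhs` between terms. -/
structure CEquation (ι : Type u) where
  lhs : CTerm ι
  rhs : CTerm ι

namespace CEquation

variable {ι : Type u}

def rename (ρ : ι → ι) (e : CEquation ι) : CEquation ι := ⟨e.lhs.rename ρ, e.rhs.rename ρ⟩

def ind (e : CEquation ι) : Set ι := e.lhs.ind ∪ e.rhs.ind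

def cylVars (i : ι) (e : CEquation ι) : CEquation ι := ⟨e.lhs.cylVars i, e.rhs.cylVars i⟩

end CEquation

/-- `A ⊨ e`: the equation `e` is valid in `A`. -/
def Models {ι : Type u} (A : CylStruct ι) (e : CEquation ι) : Prop :=
  ∀ v : ℕ → A.carrier, e.lhs.eval A v = e.rhs.eval A v

/-- The equational theory of `A`. -/
def EqTheory {ι : Type u} (A : CylStruct ι) : Set (CEquation ι) := {e | Models A e}

/-- The class of symmetric cylindric algebras. -/
def Sy (ι : Type u) : Set (CylStruct ι) :=
  {A | A ∈ CA ι ∧ ∀ (e : CEquation ι) (ρ : Equiv.Perm ι), Models A e → Models A (e.rename ρ)}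

/-- The class of inductive cylindric algebras: if `i` is not an index of an operation in `e`, then
`A ⊨ e(c i x₁, …, c i xₙ)` implies `A ⊨ e(x₁, …, xₙ)`. -/
def Ret (ι : Type u) : Set (CylStruct ι) :=
  {A | A ∈ CA ι ∧ ∀ (e : CEquation ι) (i : ι), i ∉ e.ind → Models A (e.cylVars i) → Models A e}

end CylAlg

/-!
Everything about inductive algebras rests on one observation (`eval_eq_of_fixed`): if
`e(c i x₁, …, c i xₙ)` is valid and neither `i` nor `κ` occurs in `e`, then `e` holds at all
elements that do not depend on `κ`, because such elements are carried by the substitutions between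
`i` and `κ`, in both directions, to elements of the form `c i x`. In a locally finite algebra any
finitely many elements leave some `κ` free, and in an endo-dc algebra the endomorphism supplies a
free `κ`; so both kinds of algebras are inductive. Conversely, in an inductive algebra a failing
equation `e` fails at elements independent of any given finite set of indices outside `e`. These
failures, for larger and larger finite sets, are a failure of `e` at finite-dimensional elements of
a reduced power, whose finite-dimensional part is therefore a locally finite algebra with the same
equations (`exists_Lf_eqTheory_eq`). As being inductive depends on the equational theory only, this
characterizes the inductive algebras.

*Symmetry.* If `j` does not occur in `e`, then on elements independent of `i` the substitution of
`i` for `j` carries `e` with `i` renamed to `j` back to `e`; any transposition is a composite of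
three such renamings, and a permutation agrees on the indices of `e` with a product of
transpositions (`models_rename_perm`).

*Representability.* An equation that fails in a locally finite algebra fails in the full set
algebra on some `ι → U`, by a Henkin construction with indices as constants
(`exists_map_cartesian`). Applied to the finite partial operation tables of an inductive algebra,
this gives local representations (`locallyRepresentable_of_mem_Ret`), from which an ultraproduct
and a disjoint union produce a representation (`LocallyRepresentable.mem_RCA`).

*The inclusions are proper.* Both examples are algebras of sets of sequences that are invariant
under a bisimulation. For the first one (`evenAlgebra`) the sequences are those that agree with a
permutation of `ι` at all but finitely many places, and the sets are invariant under even
permutations of the base. It is evidently representable and symmetric. If a set does not depend on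
a coordinate `m`, a missing value is free to be used by a `3`-cycle in place of a transposition, so
the binary relations extracted from the set do not separate the missing values; without such a
coordinate, a fixed-point-free permutation with cycles of length three can be defined. An equation
expresses this difference (`evenAlgebra_notMem_Ret`).

For the second one (`exists_mem_Ret_notMem_Edc`) the injective sequences over a large base are
colored by very many colors such that any color can be attained by changing any one coordinate. In
the algebra of the sets that respect coincidences and colors, an endomorphism of a reduct that does
not annihilate the injective sequences must not annihilate any color either, whereas there are few
elements independent of some coordinate. The product with the free algebra of the full set algebra
has the equational theory of the latter, which is endo-dc, hence inductive.
-/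

namespace CylAlg

variable {ι : Type u} {A B : CylStruct ι}

/-! ### Cylindrifications and substitutions -/

section Laws

variable (hA : A ∈ CA ι)
include hA

theorem c_comm (i j : ι) (x : A.carrier) : A.c i (A.c j x) = A.c j (A.c i x) := hA.1 i j x

theorem le_c (i : ι) (x : A.carrier) : x ≤ A.c i x := hA.2.1 i x

theorem c_idem (i : ι) (x : A.carrier) : A.c i (A.c i x) = A.c i x := hA.2.2.1 i x

theorem c_sup (i : ι) (x y : A.carrier) : A.c i (x ⊔ y) = A.c i x ⊔ A.c i y := hA.2.2.2.1 i x y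

theorem c_compl_c (i : ι) (x : A.carrier) : A.c i (A.c i x)ᶜ = (A.c i x)ᶜ := hA.2.2.2.2.1 i x

theorem d_self (i : ι) : A.d i i = ⊤ := hA.2.2.2.2.2.1 i

theorem d_comm (i j : ι) : A.d i j = A.d j i := hA.2.2.2.2.2.2.1 i j

theorem c_d_inf_d {i j k : ι} (hij : i ≠ j) (hik : i ≠ k) (hjk : j ≠ k) :
    A.c j (A.d i j ⊓ A.d j k) = A.d i k := hA.2.2.2.2.2.2.2.1 i j k hij hik hjk

theorem c_d {i j : ι} (hij : i ≠ j) : A.c i (A.d i j) = ⊤ := hA.2.2.2.2.2.2.2.2.1 i j hij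

theorem d_inf_c_d_inf {i j : ι} (hij : i ≠ j) (x : A.carrier) :
    A.d i j ⊓ A.c i (A.d i j ⊓ x) = A.d i j ⊓ x := hA.2.2.2.2.2.2.2.2.2 i j x hij

theorem c_mono (i : ι) {x y : A.carrier} (h : x ≤ y) : A.c i x ≤ A.c i y := by
  have := c_sup hA i x y
  rw [sup_eq_right.2 h] at this
  rw [this]
  exact le_sup_left

theorem c_top (i : ι) : A.c i ⊤ = ⊤ := top_le_iff.1 (le_c hA i ⊤)

theorem c_bot (i : ι) : A.c i ⊥ = ⊥ := by
  have := c_compl_c hA i ⊤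
  rwa [c_top hA, compl_top] at this

theorem c_compl_of_fixed {i : ι} {x : A.carrier} (h : A.c i x = x) : A.c i xᶜ = xᶜ := by
  have := c_compl_c hA i x
  rwa [h] at this

theorem c_inf_of_fixed {i : ι} (x : A.carrier) {y : A.carrier} (hy : A.c i y = y) :
    A.c i (x ⊓ y) = A.c i x ⊓ y := by
  apply le_antisymm
  · exact le_inf (c_mono hA i inf_le_left) ((c_mono hA i inf_le_right).trans hy.le)
  · have h1 : x ≤ (x ⊓ y) ⊔ yᶜ := by
      rw [sup_inf_right, sup_compl_eq_top, inf_top_eq]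
      exact le_sup_left
    have h2 := c_mono hA i h1
    rw [c_sup hA, c_compl_of_fixed hA hy] at h2
    calc A.c i x ⊓ y ≤ (A.c i (x ⊓ y) ⊔ yᶜ) ⊓ y := inf_le_inf_right _ h2
      _ = A.c i (x ⊓ y) ⊓ y := by rw [inf_sup_right, compl_inf_eq_bot, sup_bot_eq]
      _ ≤ _ := inf_le_left

theorem fixed_inf_of_fixed {i : ι} {x y : A.carrier} (hx : A.c i x = x) (hy : A.c i y = y) :
    A.c i (x ⊓ y) = x ⊓ y := by
  rw [c_inf_of_fixed hA x hy, hx]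

theorem fixed_sup_of_fixed {i : ι} {x y : A.carrier} (hx : A.c i x = x) (hy : A.c i y = y) :
    A.c i (x ⊔ y) = x ⊔ y := by
  rw [c_sup hA, hx, hy]

theorem fixed_c_of_fixed {i : ι} (j : ι) {x : A.carrier} (hx : A.c i x = x) :
    A.c i (A.c j x) = A.c j x := by
  rw [c_comm hA, hx]

/-- The diagonal `d i j` depends only on the coordinates `i` and `j`. -/
theorem fixed_d {i j k : ι} (hi : k ≠ i) (hj : k ≠ j) : A.c k (A.d i j) = A.d i j := by
  by_cases hij : i = j
  · subst hij
    rw [d_self hA, c_top hA]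
  · rw [← c_d_inf_d hA hi.symm hij hj, c_idem hA]

end Laws

/-- The substitution of the index `j` for the index `i` (meaningful for `i ≠ j`): the value at `i`
is replaced by the value at `j`. -/
def subst (A : CylStruct ι) (i j : ι) (x : A.carrier) : A.carrier := A.c i (A.d i j ⊓ x)

section Subst

variable (hA : A ∈ CA ι) {i j k l : ι}
include hA

theorem subst_sup (x y : A.carrier) : subst A i j (x ⊔ y) = subst A i j x ⊔ subst A i j y := by
  rw [subst, inf_sup_left, c_sup hA, subst, subst]

theorem subst_top (hij : i ≠ j) : subst A i j ⊤ = ⊤ := by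
  rw [subst, inf_top_eq, c_d hA hij]

theorem subst_compl (hij : i ≠ j) (x : A.carrier) : subst A i j xᶜ = (subst A i j x)ᶜ := by
  refine eq_compl_iff_isCompl.2 ⟨?_, ?_⟩
  · rw [disjoint_iff, subst, subst, ← c_inf_of_fixed hA _ (c_idem hA _ _), inf_right_comm,
      d_inf_c_d_inf hA hij, inf_assoc, inf_compl_eq_bot, inf_bot_eq, c_bot hA]
  · rw [codisjoint_iff, ← subst_sup hA, sup_comm, sup_compl_eq_top, subst_top hA hij]

theorem subst_inf (hij : i ≠ j) (x y : A.carrier) :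
    subst A i j (x ⊓ y) = subst A i j x ⊓ subst A i j y := by
  apply compl_injective
  rw [← subst_compl hA hij, compl_inf, subst_sup hA, subst_compl hA hij, subst_compl hA hij,
    compl_inf]

theorem c_subst_of_ne (hi : k ≠ i) (hj : k ≠ j) (x : A.carrier) :
    A.c k (subst A i j x) = subst A i j (A.c k x) := by
  rw [subst, subst, c_comm hA, inf_comm, c_inf_of_fixed hA _ (fixed_d hA hi hj), inf_comm]

theorem c_subst_self (x : A.carrier) : A.c i (subst A i j x) = subst A i j x := c_idem hA _ _

theorem subst_of_fixed (hij : i ≠ j) {x : A.carrier} (hx : A.c i x = x) : subst A i j x = x := by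
  rw [subst, c_inf_of_fixed hA _ hx, c_d hA hij, top_inf_eq]

theorem subst_d_of_ne (hij : i ≠ j) (hk : i ≠ k) (hl : i ≠ l) :
    subst A i j (A.d k l) = A.d k l :=
  subst_of_fixed hA hij (fixed_d hA hk hl)

theorem subst_d (hij : i ≠ j) (hik : i ≠ k) : subst A i j (A.d i k) = A.d j k := by
  by_cases hjk : j = k
  · subst hjk
    rw [subst, inf_idem, c_d hA hij, d_self hA]
  · rw [subst, d_comm hA i j, c_d_inf_d hA hij.symm hjk hik]

/-- Substitutions in the two directions are mutually inverse between the elements independent of `j`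
and those independent of `i`. -/
theorem subst_subst (hij : i ≠ j) {x : A.carrier} (hx : A.c j x = x) :
    subst A j i (subst A i j x) = x := by
  rw [subst, subst, d_comm hA j i, d_inf_c_d_inf hA hij, c_inf_of_fixed hA _ hx, d_comm hA,
    c_d hA hij.symm, top_inf_eq]

theorem c_subst_of_fixed (hij : i ≠ j) {x : A.carrier} (hx : A.c j x = x) :
    A.c j (subst A i j x) = A.c i x := by
  rw [subst, c_comm hA, c_inf_of_fixed hA _ hx, d_comm hA, c_d hA hij.symm, top_inf_eq]

end Subst

/-! ### Terms and equations -/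

namespace CTerm

theorem ind_finite (t : CTerm ι) : t.ind.Finite := by
  induction t with
  | var n => exact Set.finite_empty
  | add s t hs ht => exact hs.union ht
  | neg t ht => exact ht
  | cyl i t ht => exact ht.insert i
  | diag i j => exact (Set.finite_singleton j).insert i

/-- The set of (numbers of) variables occurring in a term. -/
def vars : CTerm ι → Set ℕ
  | var n => {n}
  | add s t => vars s ∪ vars t
  | neg t => vars t
  | cyl _ t => vars t
  | diag _ _ => ∅

theorem vars_finite (t : CTerm ι) : t.vars.Finite := by
  induction t with
  | var n => exact Set.finite_singleton n
  | add s t hs ht => exact hs.union ht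
  | neg t ht => exact ht
  | cyl i t ht => exact ht
  | diag i j => exact Set.finite_empty

theorem eval_congr {v w : ℕ → A.carrier} (t : CTerm ι) (h : ∀ n ∈ t.vars, v n = w n) :
    t.eval A v = t.eval A w := by
  induction t with
  | var n => exact h n rfl
  | add s t hs ht =>
    simp only [eval, hs fun n hn => h n (Or.inl hn), ht fun n hn => h n (Or.inr hn)]
  | neg t ht => simp only [eval, ht h]
  | cyl i t ht => simp only [eval, ht h]
  | diag i j => rfl

theorem map_eval {Γ : Set ι} {h : A.carrier → B.carrier} (hh : IsReductHom Γ A B h)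
    (v : ℕ → A.carrier) (t : CTerm ι) (ht : t.ind ⊆ Γ) :
    h (t.eval A v) = t.eval B (fun n => h (v n)) := by
  induction t with
  | var n => rfl
  | add s t hs ht' =>
    simp only [eval, hh.map_sup, hs (Set.subset_union_left.trans ht),
      ht' (Set.subset_union_right.trans ht)]
  | neg t ht' => simp only [eval, hh.map_compl, ht' ht]
  | cyl i t ht' =>
    simp only [eval, hh.map_c i (ht (Set.mem_insert _ _)),
      ht' ((Set.subset_insert _ _).trans ht)]
  | diag i j => exact hh.map_d i (ht (by simp [ind])) j (ht (by simp [ind]))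

theorem fixed_eval (hA : A ∈ CA ι) {i : ι} {v : ℕ → A.carrier} (hv : ∀ n, A.c i (v n) = v n)
    (t : CTerm ι) (ht : i ∉ t.ind) : A.c i (t.eval A v) = t.eval A v := by
  induction t with
  | var n => exact hv n
  | add s t hs ht' =>
    exact fixed_sup_of_fixed hA (hs fun h => ht (Or.inl h)) (ht' fun h => ht (Or.inr h))
  | neg t ht' => exact c_compl_of_fixed hA (ht' ht)
  | cyl j t ht' => exact fixed_c_of_fixed hA j (ht' fun h => ht (Or.inr h))
  | diag j k =>
    exact fixed_d hA (fun h => ht (by simp [ind, h])) (fun h => ht (by simp [ind, h]))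

theorem eval_cylVars (i : ι) (v : ℕ → A.carrier) (t : CTerm ι) :
    (t.cylVars i).eval A v = t.eval A (fun n => A.c i (v n)) := by
  induction t with
  | var n => rfl
  | add s t hs ht => simp only [cylVars, eval, hs, ht]
  | neg t ht => simp only [cylVars, eval, ht]
  | cyl j t ht => simp only [cylVars, eval, ht]
  | diag j k => rfl

theorem ind_cylVars_subset (i : ι) (t : CTerm ι) : (t.cylVars i).ind ⊆ insert i t.ind := by
  induction t with
  | var n => simp [cylVars, ind]
  | add s t hs ht =>
    refine Set.union_subset (hs.trans ?_) (ht.trans ?_) <;>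
      exact Set.insert_subset_insert (by simp [ind])
  | neg t ht => exact ht
  | cyl j t ht =>
    refine Set.insert_subset (by simp [ind]) (ht.trans (Set.insert_subset_insert ?_))
    exact Set.subset_insert _ _
  | diag j k => exact Set.subset_insert _ _

theorem rename_congr {ρ σ : ι → ι} (t : CTerm ι) (h : ∀ i ∈ t.ind, ρ i = σ i) :
    t.rename ρ = t.rename σ := by
  induction t with
  | var n => rfl
  | add s t hs ht =>
    simp only [rename, hs fun i hi => h i (Or.inl hi), ht fun i hi => h i (Or.inr hi)]
  | neg t ht => simp only [rename, ht h]
  | cyl i t ht =>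
    simp only [rename, h i (Set.mem_insert _ _), ht fun j hj => h j (Set.mem_insert_of_mem _ hj)]
  | diag i j => simp only [rename, h i (by simp [ind]), h j (by simp [ind])]

theorem rename_rename (ρ σ : ι → ι) (t : CTerm ι) :
    (t.rename ρ).rename σ = t.rename (σ ∘ ρ) := by
  induction t with
  | var n => rfl
  | add s t hs ht => simp only [rename, hs, ht]
  | neg t ht => simp only [rename, ht]
  | cyl i t ht => simp only [rename, ht, Function.comp]
  | diag i j => rfl

theorem rename_id (t : CTerm ι) : t.rename id = t := by
  induction t with
  | var n => rfl
  | add s t hs ht => simp only [rename, hs, ht]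
  | neg t ht => simp only [rename, ht]
  | cyl i t ht => simp only [rename, ht, id]
  | diag i j => rfl

theorem ind_rename (ρ : ι → ι) (t : CTerm ι) : (t.rename ρ).ind = ρ '' t.ind := by
  induction t with
  | var n => simp [rename, ind]
  | add s t hs ht => simp only [rename, ind, hs, ht, Set.image_union]
  | neg t ht => exact ht
  | cyl i t ht => simp only [rename, ind, ht, Set.image_insert_eq]
  | diag i j => simp only [rename, ind, Set.image_pair]

/-- The meet of two terms. -/
def inf (s t : CTerm ι) : CTerm ι := neg (add (neg s) (neg t))

/-- The symmetric difference of two terms. -/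
def symmDiff (s t : CTerm ι) : CTerm ι := add (inf s (neg t)) (inf t (neg s))

/-- The term with constant value `⊤`. -/
def top : CTerm ι := add (var 0) (neg (var 0))

theorem eval_inf (v : ℕ → A.carrier) (s t : CTerm ι) :
    (inf s t).eval A v = s.eval A v ⊓ t.eval A v := by
  simp [inf, eval]

theorem eval_symmDiff (v : ℕ → A.carrier) (s t : CTerm ι) :
    (symmDiff s t).eval A v = _root_.symmDiff (s.eval A v) (t.eval A v) := by
  simp [symmDiff, eval, eval_inf, symmDiff_eq]

theorem eval_top (v : ℕ → A.carrier) : (top : CTerm ι).eval A v = ⊤ := by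
  simp [top, eval]

end CTerm

namespace CEquation

theorem ind_finite (e : CEquation ι) : e.ind.Finite := e.lhs.ind_finite.union e.rhs.ind_finite

theorem ind_cylVars_subset (i : ι) (e : CEquation ι) : (e.cylVars i).ind ⊆ insert i e.ind :=
  Set.union_subset
    ((e.lhs.ind_cylVars_subset i).trans (Set.insert_subset_insert Set.subset_union_left))
    ((e.rhs.ind_cylVars_subset i).trans (Set.insert_subset_insert Set.subset_union_right))

theorem rename_congr {ρ σ : ι → ι} (e : CEquation ι) (h : ∀ i ∈ e.ind, ρ i = σ i) :
    e.rename ρ = e.rename σ := by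
  rw [rename, rename, e.lhs.rename_congr fun i hi => h i (Or.inl hi),
    e.rhs.rename_congr fun i hi => h i (Or.inr hi)]

theorem rename_rename (ρ σ : ι → ι) (e : CEquation ι) :
    (e.rename ρ).rename σ = e.rename (σ ∘ ρ) := by
  simp only [rename, CTerm.rename_rename]

theorem rename_id (e : CEquation ι) : e.rename id = e := by
  simp only [rename, CTerm.rename_id]

theorem ind_rename (ρ : ι → ι) (e : CEquation ι) : (e.rename ρ).ind = ρ '' e.ind := by
  simp only [rename, ind, CTerm.ind_rename, Set.image_union]

end CEquation

theorem models_cylVars_iff {i : ι} {e : CEquation ι} :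
    Models A (e.cylVars i) ↔
      ∀ v : ℕ → A.carrier, e.lhs.eval A (fun n => A.c i (v n)) =
        e.rhs.eval A (fun n => A.c i (v n)) := by
  simp only [Models, CEquation.cylVars, CTerm.eval_cylVars]

/-- Being a cylindric algebra is an equational property. -/
theorem mem_CA_of_eqTheory_subset (hA : A ∈ CA ι) (h : EqTheory A ⊆ EqTheory B) : B ∈ CA ι := by
  have key : ∀ s t : CTerm ι, (∀ v : ℕ → A.carrier, s.eval A v = t.eval A v) →
      ∀ v : ℕ → B.carrier, s.eval B v = t.eval B v := fun s t hst =>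
    h (show (⟨s, t⟩ : CEquation ι) ∈ EqTheory A from hst)
  let x : CTerm ι := .var 0
  let y : CTerm ι := .var 1
  refine ⟨fun i j a => ?_, fun i a => ?_, fun i a => ?_, fun i a b => ?_, fun i a => ?_,
    fun i => ?_, fun i j => ?_, fun i j k hij hik hjk => ?_, fun i j hij => ?_,
    fun i j a hij => ?_⟩
  · exact key (.cyl i (.cyl j x)) (.cyl j (.cyl i x)) (fun v => c_comm hA i j _) fun _ => a
  · exact sup_eq_right.1 (key (.add x (.cyl i x)) (.cyl i x)
      (fun v => sup_eq_right.2 (le_c hA i _)) fun _ => a)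
  · exact key (.cyl i (.cyl i x)) (.cyl i x) (fun v => c_idem hA i _) fun _ => a
  · exact key (.cyl i (.add x y)) (.add (.cyl i x) (.cyl i y)) (fun v => c_sup hA i _ _)
      fun n => if n = 0 then a else b
  · exact key (.cyl i (.neg (.cyl i x))) (.neg (.cyl i x)) (fun v => c_compl_c hA i _) fun _ => a
  · have := key (.diag i i) .top (fun v => (d_self hA i).trans (CTerm.eval_top v).symm) fun _ => ⊥
    rwa [CTerm.eval_top] at this
  · exact key (.diag i j) (.diag j i) (fun v => d_comm hA i j) fun _ => ⊥
  · have := key (.cyl j (.inf (.diag i j) (.diag j k))) (.diag i k)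
      (fun v => by
        rw [CTerm.eval, CTerm.eval_inf]
        exact c_d_inf_d hA hij hik hjk) fun _ => ⊥
    rwa [CTerm.eval, CTerm.eval_inf] at this
  · have := key (.cyl i (.diag i j)) .top
      (fun v => (c_d hA hij).trans (CTerm.eval_top v).symm) fun _ => ⊥
    rwa [CTerm.eval_top] at this
  · have := key (.inf (.diag i j) (.cyl i (.inf (.diag i j) x))) (.inf (.diag i j) x)
      (fun v => by
        rw [CTerm.eval_inf, CTerm.eval, CTerm.eval_inf]
        exact d_inf_c_d_inf hA hij _) fun _ => a
    rwa [CTerm.eval_inf, CTerm.eval, CTerm.eval_inf] at this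

/-! ### Subalgebras, products and reduced powers -/

/-- An injective homomorphism reflects the validity of equations. -/
theorem eqTheory_subset_of_injective {h : A.carrier → B.carrier}
    (hh : IsReductHom Set.univ A B h) (hinj : Function.Injective h) :
    EqTheory B ⊆ EqTheory A := by
  intro e he v
  apply hinj
  rw [CTerm.map_eval hh _ _ (Set.subset_univ _), CTerm.map_eval hh _ _ (Set.subset_univ _)]
  exact he _

/-- A surjective homomorphism preserves the validity of equations. -/
theorem eqTheory_subset_of_surjective {h : A.carrier → B.carrier}
    (hh : IsReductHom Set.univ A B h) (hsurj : Function.Surjective h) :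
    EqTheory A ⊆ EqTheory B := by
  intro e he v
  obtain ⟨w, rfl⟩ := hsurj.comp_left v
  have := congrArg h (he w)
  rwa [CTerm.map_eval hh _ _ (Set.subset_univ _),
    CTerm.map_eval hh _ _ (Set.subset_univ _)] at this

/-- The subalgebra of `A` on a Boolean subalgebra closed under the cylindric operations. -/
def restrict (A : CylStruct ι) (L : BooleanSubalgebra A.carrier)
    (hc : ∀ i, ∀ x ∈ L, A.c i x ∈ L) (hd : ∀ i j, A.d i j ∈ L) : CylStruct ι where
  carrier := L
  c i x := ⟨A.c i x, hc i x x.2⟩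
  d i j := ⟨A.d i j, hd i j⟩

section Restrict

variable {L : BooleanSubalgebra A.carrier} {hc : ∀ i, ∀ x ∈ L, A.c i x ∈ L}
  {hd : ∀ i j, A.d i j ∈ L}

theorem isReductHom_val (Γ : Set ι) : IsReductHom Γ (restrict A L hc hd) A (fun x => x.1) :=
  ⟨fun _ _ => rfl, fun _ => rfl, fun _ _ _ => rfl, fun _ _ _ _ => rfl⟩

theorem eqTheory_subset_restrict : EqTheory A ⊆ EqTheory (restrict A L hc hd) :=
  eqTheory_subset_of_injective (isReductHom_val _) Subtype.val_injective

theorem coe_eval_restrict (v : ℕ → (restrict A L hc hd).carrier) (t : CTerm ι) :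
    (t.eval (restrict A L hc hd) v).1 = t.eval A (fun n => (v n).1) :=
  CTerm.map_eval (isReductHom_val Set.univ) v t (Set.subset_univ _)

end Restrict

/-- The direct power `A ^ I`. -/
def power (A : CylStruct ι) (I : Type u) : CylStruct ι where
  carrier := I → A.carrier
  c i x := fun k => A.c i (x k)
  d i j := fun _ => A.d i j

theorem isReductHom_proj (Γ : Set ι) (I : Type u) (k : I) :
    IsReductHom Γ (power A I) A (fun x => x k) :=
  ⟨fun _ _ => rfl, fun _ => rfl, fun _ _ _ => rfl, fun _ _ _ _ => rfl⟩

theorem eval_power (I : Type u) (v : ℕ → (power A I).carrier) (t : CTerm ι) (k : I) :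
    t.eval (power A I) v k = t.eval A (fun n => v n k) :=
  CTerm.map_eval (isReductHom_proj Set.univ I k) v t (Set.subset_univ _)

theorem eqTheory_subset_power (I : Type u) : EqTheory A ⊆ EqTheory (power A I) := by
  intro e he v
  funext k
  rw [eval_power, eval_power]
  exact he _

/-- The direct product of two algebras. -/
def prod (A B : CylStruct ι) : CylStruct ι where
  carrier := A.carrier × B.carrier
  c i x := (A.c i x.1, B.c i x.2)
  d i j := (A.d i j, B.d i j)

theorem isReductHom_fst (Γ : Set ι) : IsReductHom Γ (prod A B) A Prod.fst :=
  ⟨fun _ _ => rfl, fun _ => rfl, fun _ _ _ => rfl, fun _ _ _ _ => rfl⟩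

theorem isReductHom_snd (Γ : Set ι) : IsReductHom Γ (prod A B) B Prod.snd :=
  ⟨fun _ _ => rfl, fun _ => rfl, fun _ _ _ => rfl, fun _ _ _ _ => rfl⟩

theorem eqTheory_prod : EqTheory (prod A B) = EqTheory A ∩ EqTheory B := by
  apply Set.Subset.antisymm
  · exact Set.subset_inter
      (eqTheory_subset_of_surjective (isReductHom_fst _) fun a => ⟨(a, ⊥), rfl⟩)
      (eqTheory_subset_of_surjective (isReductHom_snd _) fun b => ⟨(⊥, b), rfl⟩)
  · rintro e ⟨h1, h2⟩ v
    apply Prod.ext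
    · rw [CTerm.map_eval (isReductHom_fst Set.univ) _ _ (Set.subset_univ _),
        CTerm.map_eval (isReductHom_fst Set.univ) _ _ (Set.subset_univ _)]
      exact h1 _
    · rw [CTerm.map_eval (isReductHom_snd Set.univ) _ _ (Set.subset_univ _),
        CTerm.map_eval (isReductHom_snd Set.univ) _ _ (Set.subset_univ _)]
      exact h2 _

section ReducedPower

open Filter

instance {I : Type*} (l : Filter I) (β : Type*) [BooleanAlgebra β] : BooleanAlgebra (Germ l β) where
  __ := (inferInstance : DistribLattice (Germ l β))
  __ := (inferInstance : BoundedOrder (Germ l β))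
  compl := Germ.map (·ᶜ)
  inf_compl_le_bot x := by
    induction x using Germ.inductionOn with
    | _ f => exact Eventually.of_forall fun _ => inf_compl_eq_bot.le
  top_le_sup_compl x := by
    induction x using Germ.inductionOn with
    | _ f => exact Eventually.of_forall fun _ => sup_compl_eq_top.ge

/-- The reduced power of `A` modulo the filter `l`. -/
def reducedPower (A : CylStruct ι) {I : Type u} (l : Filter I) : CylStruct ι where
  carrier := Germ l A.carrier
  c i := Germ.map (A.c i)
  d i j := ((A.d i j : A.carrier) : Germ l A.carrier)

variable {I : Type u} {l : Filter I}

/-- The class of a family modulo the filter `l`. -/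
def toReduced (A : CylStruct ι) (l : Filter I) (f : I → A.carrier) : (reducedPower A l).carrier :=
  Germ.ofFun f

theorem toReduced_eq_iff {f g : I → A.carrier} :
    toReduced A l f = toReduced A l g ↔ ∀ᶠ k in l, f k = g k := Germ.coe_eq

theorem c_toReduced (i : ι) (f : I → A.carrier) :
    (reducedPower A l).c i (toReduced A l f) = toReduced A l fun k => A.c i (f k) := rfl

theorem isReductHom_toReduced : IsReductHom Set.univ (power A I) (reducedPower A l)
    (toReduced A l) :=
  ⟨fun _ _ => rfl, fun _ => rfl, fun _ _ _ => rfl, fun _ _ _ _ => rfl⟩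

theorem toReduced_surjective : Function.Surjective (toReduced A l) := fun x =>
  Germ.inductionOn (p := fun y => ∃ f, toReduced A l f = y) x fun f => ⟨f, rfl⟩

theorem eqTheory_subset_reducedPower : EqTheory A ⊆ EqTheory (reducedPower A l) :=
  (eqTheory_subset_power I).trans
    (eqTheory_subset_of_surjective isReductHom_toReduced toReduced_surjective)

theorem eval_reducedPower (f : ℕ → I → A.carrier) (t : CTerm ι) :
    t.eval (reducedPower A l) (fun n => toReduced A l (f n)) =
      toReduced A l fun k => t.eval A fun n => f n k := by
  rw [← CTerm.map_eval (A := power A I) isReductHom_toReduced f t (Set.subset_univ _)]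
  exact congrArg _ (funext fun k => eval_power I f t k)

end ReducedPower

/-! ### Spare dimensions and inductive algebras -/

/-- Substituting one index for another is an endomorphism of every reduct avoiding both. -/
theorem isReductHom_subst (hA : A ∈ CA ι) {i j : ι} (hij : i ≠ j) {Γ : Set ι} (hi : i ∉ Γ)
    (hj : j ∉ Γ) : IsReductHom Γ A A (subst A i j) where
  map_sup := subst_sup hA
  map_compl := subst_compl hA hij
  map_c _ hk x := (c_subst_of_ne hA (ne_of_mem_of_not_mem hk hi) (ne_of_mem_of_not_mem hk hj) x).symm
  map_d _ hk _ hl := subst_d_of_ne hA hij (ne_of_mem_of_not_mem hk hi).symm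
    (ne_of_mem_of_not_mem hl hi).symm

/-- If `e(c i x₁, …, c i xₙ)` is valid, then `e` holds at all elements that do not depend on `κ`,
for any further index `κ` outside `e`: such elements can be made independent of `i` by
substituting `κ` for `i`, and this is undone by substituting `i` for `κ`. -/
theorem eval_eq_of_fixed (hA : A ∈ CA ι) {e : CEquation ι} {i κ : ι} (hi : i ∉ e.ind)
    (hκ : κ ∉ e.ind) (he : Models A (e.cylVars i)) {v : ℕ → A.carrier}
    (hv : ∀ n, A.c κ (v n) = v n) : e.lhs.eval A v = e.rhs.eval A v := by
  rw [models_cylVars_iff] at he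
  by_cases hiκ : i = κ
  · subst hiκ
    simpa only [hv] using he v
  have h1 := he fun n => subst A i κ (v n)
  simp only [c_subst_self hA] at h1
  have h2 := congrArg (subst A κ i) h1
  have hh := isReductHom_subst hA (Ne.symm hiκ) hκ hi
  rw [CTerm.map_eval hh _ _ Set.subset_union_left,
    CTerm.map_eval hh _ _ Set.subset_union_right] at h2
  simpa only [subst_subst hA hiκ (hv _)] using h2

/-- If an equation fails in an endo-dc algebra, an endomorphism that keeps the symmetric difference of
the two sides nonzero moves the failure to elements independent of some `κ`. -/
theorem Edc_subset_Ret : Edc ι ⊆ Ret ι := by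
  rintro A ⟨hA, h⟩
  refine ⟨hA, fun e i hi he v => ?_⟩
  by_contra hne
  obtain ⟨κ, hκ, g, hg, hg0, hgκ⟩ := h e.ind e.ind_finite
    (symmDiff (e.lhs.eval A v) (e.rhs.eval A v)) (fun h => hne (symmDiff_eq_bot.1 h))
  apply hg0
  have hs : ∀ s t : CTerm ι, s.ind ⊆ e.ind → t.ind ⊆ e.ind →
      g (symmDiff (s.eval A v) (t.eval A v)) =
        symmDiff (s.eval A fun n => g (v n)) (t.eval A fun n => g (v n)) := by
    intro s t hs ht
    rw [← CTerm.eval_symmDiff, ← CTerm.eval_symmDiff]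
    refine CTerm.map_eval hg v _ ?_
    simp [CTerm.symmDiff, CTerm.inf, CTerm.ind, hs, ht]
  rw [hs _ _ Set.subset_union_left Set.subset_union_right, symmDiff_eq_bot]
  exact eval_eq_of_fixed hA hi hκ he fun n => hgκ (v n)

/-- Finitely many elements of a locally finite algebra are all independent of some index. -/
theorem Lf_subset_Ret [Infinite ι] : Lf ι ⊆ Ret ι := by
  rintro A ⟨hA, h⟩
  refine ⟨hA, fun e i hi he v => ?_⟩
  have hvars : (e.lhs.vars ∪ e.rhs.vars).Finite := e.lhs.vars_finite.union e.rhs.vars_finite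
  obtain ⟨κ, hκ⟩ := ((hvars.biUnion fun n _ => h (v n)).union e.ind_finite).infinite_compl.nonempty
  rw [Set.mem_compl_iff, Set.mem_union, not_or] at hκ
  classical
  let w : ℕ → A.carrier := fun n => if n ∈ e.lhs.vars ∪ e.rhs.vars then v n else ⊥
  have hw : ∀ n, A.c κ (w n) = w n := by
    intro n
    by_cases hn : n ∈ e.lhs.vars ∪ e.rhs.vars
    · simp only [w, if_pos hn]
      by_contra hne
      exact hκ.1 (Set.mem_biUnion hn hne)
    · simp only [w, if_neg hn, c_bot hA]
  rw [e.lhs.eval_congr (w := w) fun n hn => (if_pos (Or.inl hn)).symm,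
    e.rhs.eval_congr (w := w) fun n hn => (if_pos (Or.inr hn)).symm]
  exact eval_eq_of_fixed hA hi hκ.2 he hw

theorem mem_Ret_of_eqTheory_eq (hA : A ∈ Ret ι) (h : EqTheory A = EqTheory B) : B ∈ Ret ι := by
  refine ⟨mem_CA_of_eqTheory_subset hA.1 h.subset, fun e i hi he => ?_⟩
  have h1 : e.cylVars i ∈ EqTheory A := h.symm.subset he
  exact h.subset (show e ∈ EqTheory A from hA.2 e i hi h1)

/-- In an inductive algebra, a failing equation fails at elements that are independent of any
prescribed finite set of indices outside the equation. -/
theorem exists_fixed_eval_ne (hA : A ∈ Ret ι) (e : CEquation ι) (he : ¬ Models A e)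
    (Δ : Finset ι) : ∃ v : ℕ → A.carrier, (∀ i ∈ Δ, i ∉ e.ind → ∀ n, A.c i (v n) = v n) ∧
      e.lhs.eval A v ≠ e.rhs.eval A v := by
  classical
  induction Δ using Finset.induction_on generalizing e with
  | empty =>
    simp only [Models, not_forall] at he
    obtain ⟨v, hv⟩ := he
    exact ⟨v, by simp, hv⟩
  | insert i Δ hi ih =>
    by_cases hie : i ∈ e.ind
    · obtain ⟨v, hv, hne⟩ := ih e he
      refine ⟨v, fun j hj hje => hv j ?_ hje, hne⟩
      exact (Finset.mem_insert.1 hj).resolve_left fun h => hje (h ▸ hie)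
    · obtain ⟨v, hv, hne⟩ := ih (e.cylVars i) fun h => he (hA.2 e i hie h)
      refine ⟨fun n => A.c i (v n), fun j hj hje n => ?_, ?_⟩
      · rcases Finset.mem_insert.1 hj with rfl | hj'
        · exact c_idem hA.1 j _
        · refine fixed_c_of_fixed hA.1 i (hv j hj' (fun h => ?_) n)
          rcases e.ind_cylVars_subset i h with rfl | h
          · exact hi hj'
          · exact hje h
      · simpa only [CEquation.cylVars, CTerm.eval_cylVars] using hne

/-- The elements of a cylindric algebra that depend on finitely many indices only. -/
def finiteDim (hA : A ∈ CA ι) : BooleanSubalgebra A.carrier where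
  carrier := {x | {i | A.c i x ≠ x}.Finite}
  supClosed' x hx y hy := (hx.union hy).subset fun i hi => by
    by_contra h
    simp only [Set.mem_union, Set.mem_ofPred_eq, not_or, not_not] at h
    exact hi (fixed_sup_of_fixed hA h.1 h.2)
  infClosed' x hx y hy := (hx.union hy).subset fun i hi => by
    by_contra h
    simp only [Set.mem_union, Set.mem_ofPred_eq, not_or, not_not] at h
    exact hi (fixed_inf_of_fixed hA h.1 h.2)
  compl_mem' {x} hx := hx.subset fun _ hi h => hi (c_compl_of_fixed hA h)
  bot_mem' := by simp [c_bot hA]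

theorem mem_finiteDim {hA : A ∈ CA ι} {x : A.carrier} :
    x ∈ finiteDim hA ↔ {i | A.c i x ≠ x}.Finite := Iff.rfl

theorem c_mem_finiteDim (hA : A ∈ CA ι) (j : ι) (x : A.carrier) (hx : x ∈ finiteDim hA) :
    A.c j x ∈ finiteDim hA :=
  (mem_finiteDim.1 hx).subset fun _ hi h => hi (fixed_c_of_fixed hA j h)

theorem d_mem_finiteDim (hA : A ∈ CA ι) (i j : ι) : A.d i j ∈ finiteDim hA :=
  (Set.toFinite {i, j}).subset fun k hk => by
    by_contra h
    simp only [Set.mem_insert_iff, Set.mem_singleton_iff, not_or] at h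
    exact hk (fixed_d hA h.1 h.2)

/-- The locally finite dimensional subalgebra of a cylindric algebra. -/
def lfPart (hA : A ∈ CA ι) : CylStruct ι :=
  restrict A (finiteDim hA) (c_mem_finiteDim hA) (d_mem_finiteDim hA)

theorem coe_eval_lfPart {hA : A ∈ CA ι} (v : ℕ → (lfPart hA).carrier) (t : CTerm ι) :
    (t.eval (lfPart hA) v).1 = t.eval A (fun n => (v n).1) := coe_eval_restrict v t

theorem lfPart_mem_Lf (hA : A ∈ CA ι) : lfPart hA ∈ Lf ι := by
  refine ⟨mem_CA_of_eqTheory_subset hA eqTheory_subset_restrict, fun x => ?_⟩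
  refine Set.Finite.subset x.2 fun i hi h => hi (Subtype.ext h)

open Filter in
/-- Every inductive algebra has the equational theory of a locally finite dimensional one: the
finite-dimensional elements of a reduced power over the finite sets of indices. -/
theorem exists_Lf_eqTheory_eq (hA : A ∈ Ret ι) : ∃ B ∈ Lf ι, EqTheory A = EqTheory B := by
  have hR : reducedPower A (atTop : Filter (Finset ι)) ∈ CA ι :=
    mem_CA_of_eqTheory_subset hA.1 eqTheory_subset_reducedPower
  refine ⟨lfPart hR, lfPart_mem_Lf hR, Set.Subset.antisymm
    (eqTheory_subset_reducedPower.trans eqTheory_subset_restrict) fun e he => ?_⟩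
  by_contra hne
  choose v hv hvne using exists_fixed_eval_ne hA e hne
  have hw : ∀ n, toReduced A atTop (fun Δ => v Δ n) ∈ finiteDim hR := by
    intro n
    refine mem_finiteDim.2 (e.ind_finite.subset fun i hi => ?_)
    by_contra hie
    refine hi ?_
    rw [c_toReduced, toReduced_eq_iff]
    filter_upwards [eventually_ge_atTop {i}] with Δ hΔ
    exact hv Δ i (hΔ (Finset.mem_singleton_self i)) hie n
  have h1 : e.lhs.eval (reducedPower A atTop) (fun n => toReduced A atTop fun Δ => v Δ n) =
      e.rhs.eval (reducedPower A atTop) (fun n => toReduced A atTop fun Δ => v Δ n) :=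
    (coe_eval_lfPart (hA := hR) (fun n => ⟨_, hw n⟩) e.lhs).symm.trans
      ((congrArg Subtype.val (he _)).trans (coe_eval_lfPart _ e.rhs))
  rw [eval_reducedPower, eval_reducedPower,
    toReduced_eq_iff] at h1
  obtain ⟨Δ, hΔ⟩ := h1.exists
  exact hvne Δ hΔ

/-! ### Symmetry of inductive algebras -/

open Classical in
/-- Renaming an index into one that does not occur preserves validity in inductive algebras. -/
theorem models_rename_swap_of_notMem (hA : A ∈ Ret ι) {e : CEquation ι} (he : Models A e)
    {i j : ι} (hj : j ∉ e.ind) : Models A (e.rename (Equiv.swap i j)) := by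
  by_cases hij : i = j
  · subst hij
    rw [Equiv.swap_self]
    exact e.rename_id.symm ▸ he
  by_cases hie : i ∈ e.ind
  swap
  · rwa [e.rename_congr (σ := id), e.rename_id]
    intro k hk
    exact Equiv.swap_apply_of_ne_of_ne (fun h => hie (h ▸ hk)) fun h => hj (h ▸ hk)
  have hCA := hA.1
  refine hA.2 _ i ?_ ?_
  · rw [CEquation.ind_rename]
    rintro ⟨k, hk, h⟩
    rw [Equiv.swap_apply_eq_iff, Equiv.swap_apply_left] at h
    exact hj (h ▸ hk)
  rw [models_cylVars_iff]
  intro v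
  -- On elements independent of `i`, substituting `i` for `j` turns `c j` into `c i`.
  have hfix : ∀ t : CTerm ι, j ∉ t.ind →
      A.c i ((t.rename (Equiv.swap i j)).eval A fun n => A.c i (v n)) =
        (t.rename (Equiv.swap i j)).eval A fun n => A.c i (v n) := by
    intro t ht
    refine CTerm.fixed_eval hCA (fun n => c_idem hCA i (v n)) _ ?_
    rw [CTerm.ind_rename]
    rintro ⟨k, hk, h⟩
    rw [Equiv.swap_apply_eq_iff, Equiv.swap_apply_left] at h
    exact ht (h ▸ hk)
  have key : ∀ t : CTerm ι, j ∉ t.ind →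
      subst A j i ((t.rename (Equiv.swap i j)).eval A fun n => A.c i (v n)) =
        t.eval A fun n => subst A j i (A.c i (v n)) := by
    intro t ht
    have hswap : ∀ k, k ≠ i → k ≠ j → Equiv.swap i j k = k := fun k =>
      Equiv.swap_apply_of_ne_of_ne
    induction t with
    | var n => rfl
    | add s t ihs iht =>
      simp only [CTerm.rename, CTerm.eval, subst_sup hCA, ihs fun h => ht (Or.inl h),
        iht fun h => ht (Or.inr h)]
    | neg t iht =>
      simp only [CTerm.rename, CTerm.eval, subst_compl hCA (Ne.symm hij), iht ht]
    | cyl k t iht =>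
      have htj : j ∉ t.ind := fun h => ht (Or.inr h)
      have hkj : k ≠ j := fun h => ht (Or.inl h.symm)
      simp only [CTerm.rename, CTerm.eval]
      rw [← iht htj]
      by_cases hki : k = i
      · subst hki
        rw [Equiv.swap_apply_left, c_subst_of_fixed hCA (Ne.symm hij) (hfix t htj),
          subst_of_fixed hCA (Ne.symm hij) (c_idem hCA _ _)]
      · rw [hswap k hki hkj, c_subst_of_ne hCA hkj hki]
    | diag k l =>
      have hkj : k ≠ j := fun h => ht (by simp [CTerm.ind, h])
      have hlj : l ≠ j := fun h => ht (by simp [CTerm.ind, h])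
      simp only [CTerm.rename, CTerm.eval]
      by_cases hki : k = i
      · by_cases hli : l = i
        · rw [hki, hli, d_self hCA, d_self hCA, subst_top hCA (Ne.symm hij)]
        · rw [hki, Equiv.swap_apply_left, hswap l hli hlj, subst_d hCA (Ne.symm hij) hlj.symm]
      · by_cases hli : l = i
        · rw [hli, Equiv.swap_apply_left, hswap k hki hkj, d_comm hCA k j,
            subst_d hCA (Ne.symm hij) hkj.symm, d_comm hCA]
        · rw [hswap k hki hkj, hswap l hli hlj,
            subst_d_of_ne hCA (Ne.symm hij) hkj.symm hlj.symm]
  have hl : j ∉ e.lhs.ind := fun h => hj (Or.inl h)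
  have hr : j ∉ e.rhs.ind := fun h => hj (Or.inr h)
  have h1 := he fun n => subst A j i (A.c i (v n))
  rw [← key e.lhs hl, ← key e.rhs hr] at h1
  have h2 := congrArg (subst A i j) h1
  rwa [subst_subst hCA (Ne.symm hij) (hfix _ hl), subst_subst hCA (Ne.symm hij) (hfix _ hr)] at h2

open Classical in
/-- A transposition is a composite of three renamings into indices that do not occur. -/
theorem models_rename_swap [Infinite ι] (hA : A ∈ Ret ι) {e : CEquation ι} (he : Models A e)
    (i j : ι) : Models A (e.rename (Equiv.swap i j)) := by
  by_cases hij : i = j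
  · subst hij
    rw [Equiv.swap_self]
    exact e.rename_id.symm ▸ he
  -- A fresh index `k` serves as intermediate storage: `i ↦ k`, then `j ↦ i`, then `k ↦ j`.
  obtain ⟨k, hk⟩ := (e.ind_finite.union (Set.toFinite {i, j})).infinite_compl.nonempty
  simp only [Set.mem_compl_iff, Set.mem_union, Set.mem_insert_iff, Set.mem_singleton_iff,
    not_or] at hk
  obtain ⟨hke, hki, hkj⟩ := hk
  have h1 := models_rename_swap_of_notMem hA he (i := i) hke
  have h2 := models_rename_swap_of_notMem hA h1 (i := j) (j := i) (by
    rw [CEquation.ind_rename]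
    rintro ⟨l, hl, h⟩
    rw [Equiv.swap_apply_eq_iff, Equiv.swap_apply_left] at h
    exact hke (h ▸ hl))
  have h3 := models_rename_swap_of_notMem hA h2 (i := k) (j := j) (by
    rw [CEquation.rename_rename, CEquation.ind_rename]
    rintro ⟨l, hl, h⟩
    rw [Function.comp, Equiv.swap_apply_eq_iff, Equiv.swap_apply_left,
      Equiv.swap_apply_eq_iff, Equiv.swap_apply_left] at h
    exact hke (h ▸ hl))
  rw [CEquation.rename_rename, CEquation.rename_rename] at h3
  rwa [e.rename_congr (σ := Equiv.swap k j ∘ Equiv.swap j i ∘ Equiv.swap i k)]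
  intro l hl
  have hlk : l ≠ k := fun h => hke (h ▸ hl)
  simp only [Function.comp, Equiv.swap_apply_def]
  grind

open Classical in
/-- Every permutation agrees on a finite set with a product of transpositions. -/
theorem models_rename_perm [Infinite ι] (hA : A ∈ Ret ι) {e : CEquation ι} (he : Models A e)
    (ρ : Equiv.Perm ι) : Models A (e.rename ρ) := by
  have key : ∀ s : Finset ι, ∃ σ : Equiv.Perm ι, (∀ i ∈ s, ρ i = σ i) ∧
      Models A (e.rename σ) := by
    intro s
    induction s using Finset.induction_on with
    | empty => exact ⟨1, by simp, by rwa [Equiv.Perm.coe_one, e.rename_id]⟩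
    | insert a s ha ih =>
      obtain ⟨σ, hσ, hm⟩ := ih
      refine ⟨Equiv.swap (σ a) (ρ a) * σ, fun i hi => ?_, ?_⟩
      · rcases Finset.mem_insert.1 hi with rfl | hi
        · simp
        · have hia : i ≠ a := fun h => ha (h ▸ hi)
          rw [Equiv.Perm.mul_apply, Equiv.swap_apply_of_ne_of_ne, hσ i hi]
          · exact fun h => hia (σ.injective h)
          · rw [← hσ i hi]
            exact fun h => hia (ρ.injective h)
      · rw [Equiv.Perm.coe_mul, ← CEquation.rename_rename]
        exact models_rename_swap hA hm _ _
  obtain ⟨σ, hσ, hm⟩ := key e.ind_finite.toFinset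
  rwa [e.rename_congr fun i hi => hσ i (e.ind_finite.mem_toFinset.2 hi)]

theorem Ret_subset_Sy [Infinite ι] : Ret ι ⊆ Sy ι := fun _ hA =>
  ⟨hA.1, fun _ ρ he => models_rename_perm hA he ρ⟩

/-! ### Full set algebras -/

section FullSetAlgebra

variable {U : Type u} {V : Set (ι → U)}

instance : SetLike (fullSetAlgebra V).carrier V where
  coe X := (X : Set V)
  coe_injective _ _ h := h

/-- `V` is closed under changing sequences at one index. -/
def UpdateClosed (V : Set (ι → U)) : Prop :=
  ∀ s ∈ V, ∀ i, ∀ t : ι → U, (∀ j, j ≠ i → t j = s j) → t ∈ V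

theorem UpdateClosed.update_mem [DecidableEq ι] (hV : UpdateClosed V) (s : V) (i : ι) (u : U) :
    Function.update s.1 i u ∈ V :=
  hV s.1 s.2 i _ fun _ hj => Function.update_of_ne hj _ _

/-- The element of a full set algebra determined by a predicate. -/
def setAlgebraOf (p : V → Prop) : (fullSetAlgebra V).carrier := ({t | p t} : Set V)

theorem mem_setAlgebraOf {p : V → Prop} {t : V} : t ∈ setAlgebraOf p ↔ p t := Iff.rfl

theorem mem_fullSetAlgebra_sup {X Y : (fullSetAlgebra V).carrier} {t : V} :
    t ∈ X ⊔ Y ↔ t ∈ X ∨ t ∈ Y := Iff.rfl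

theorem mem_fullSetAlgebra_inf {X Y : (fullSetAlgebra V).carrier} {t : V} :
    t ∈ X ⊓ Y ↔ t ∈ X ∧ t ∈ Y := Iff.rfl

theorem mem_fullSetAlgebra_compl {X : (fullSetAlgebra V).carrier} {t : V} :
    t ∈ Xᶜ ↔ t ∉ X := Iff.rfl

theorem notMem_fullSetAlgebra_bot {t : V} : t ∉ (⊥ : (fullSetAlgebra V).carrier) := id

theorem mem_fullSetAlgebra_d {i j : ι} {t : V} : t ∈ (fullSetAlgebra V).d i j ↔ t.1 i = t.1 j :=
  Iff.rfl

theorem fullSetAlgebra_ne_bot_iff {X : (fullSetAlgebra V).carrier} : X ≠ ⊥ ↔ ∃ t, t ∈ X :=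
  Set.nonempty_iff_ne_empty.symm

theorem mem_fullSetAlgebra_c {i : ι} {X : (fullSetAlgebra V).carrier} {t : V} :
    t ∈ (fullSetAlgebra V).c i X ↔ ∃ s ∈ X, ∀ j, j ≠ i → t.1 j = s.1 j := Iff.rfl

theorem mem_fullSetAlgebra_c_iff_update [DecidableEq ι] (hV : UpdateClosed V) {i : ι}
    {X : (fullSetAlgebra V).carrier} {t : V} : t ∈ (fullSetAlgebra V).c i X ↔
      ∃ u, (⟨Function.update t.1 i u, hV.update_mem t i u⟩ : V) ∈ X := by
  rw [mem_fullSetAlgebra_c]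
  constructor
  · rintro ⟨s, hs, h⟩
    refine ⟨s.1 i, ?_⟩
    convert! hs
    funext j
    by_cases hj : j = i
    · subst hj
      simp
    · rw [Function.update_of_ne hj, h j hj]
  · rintro ⟨u, hu⟩
    exact ⟨_, hu, fun j hj => (Function.update_of_ne hj _ _).symm⟩

/-- Set algebras whose unit is closed under changing one coordinate are cylindric algebras. -/
theorem fullSetAlgebra_mem_CA (hV : UpdateClosed V) : fullSetAlgebra V ∈ CA ι := by
  classical
  have hc : ∀ {i : ι} {X : (fullSetAlgebra V).carrier} {t : V}, t ∈ (fullSetAlgebra V).c i X ↔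
      ∃ u, (⟨Function.update t.1 i u, hV.update_mem t i u⟩ : V) ∈ X :=
    mem_fullSetAlgebra_c_iff_update hV
  refine ⟨fun i j X => ?_, fun i X t ht => ⟨t, ht, fun _ _ => rfl⟩, fun i X => ?_,
    fun i X Y => ?_, fun i X => ?_, fun i => ?_, fun i j => ?_, fun i j k hij hik hjk => ?_,
    fun i j hij => ?_, fun i j X hij => ?_⟩ <;> refine SetLike.ext fun t => ?_
  · by_cases hij : i = j
    · rw [hij]
    · simp only [hc]
      constructor
      · rintro ⟨u, v, h⟩
        exact ⟨v, u, by simpa only [Function.update_comm (Ne.symm hij)] using h⟩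
      · rintro ⟨u, v, h⟩
        exact ⟨v, u, by simpa only [Function.update_comm hij] using h⟩
  · simp only [hc, Function.update_idem]
    exact ⟨fun ⟨_, h⟩ => h, fun ⟨u, h⟩ => ⟨u, u, h⟩⟩
  · simp only [hc, mem_fullSetAlgebra_sup, exists_or]
  · simp only [hc, mem_fullSetAlgebra_compl, Function.update_idem]
    exact ⟨fun ⟨_, h⟩ => h, fun h => ⟨t.1 i, h⟩⟩
  · exact ⟨fun _ => trivial, fun _ => rfl⟩
  · exact ⟨Eq.symm, Eq.symm⟩
  · simp only [hc, mem_fullSetAlgebra_inf, mem_fullSetAlgebra_d, Function.update_self,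
      Function.update_of_ne hij, Function.update_of_ne (Ne.symm hjk)]
    exact ⟨fun ⟨u, h1, h2⟩ => h1.trans h2, fun h => ⟨t.1 i, rfl, h⟩⟩
  · simp only [hc, mem_fullSetAlgebra_d, Function.update_self,
      Function.update_of_ne (Ne.symm hij)]
    exact ⟨fun _ => trivial, fun _ => ⟨_, rfl⟩⟩
  · simp only [mem_fullSetAlgebra_inf]
    refine and_congr_right fun ht => ⟨fun h => ?_, fun h => ⟨t, ⟨ht, h⟩, fun _ _ => rfl⟩⟩
    rw [mem_fullSetAlgebra_d] at ht
    obtain ⟨u, hu⟩ := hc.1 h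
    rw [mem_fullSetAlgebra_inf, mem_fullSetAlgebra_d] at hu
    simp only [Function.update_self, Function.update_of_ne (Ne.symm hij)] at hu
    simpa only [hu.1, ← ht, Function.update_eq_self] using hu.2

end FullSetAlgebra

/-! ### Simultaneous substitutions -/

/-- Substituting `t γ` for `γ`, for all `γ` in the list `l`. -/
def substList (A : CylStruct ι) (t : ι → ι) : List ι → A.carrier → A.carrier
  | [], x => x
  | γ :: l, x => subst A γ (t γ) (substList A t l x)

section SubstList

variable (hA : A ∈ CA ι) {t : ι → ι} {l : List ι}
include hA

theorem subst_comm {i j k m : ι} (hij : i ≠ j) (him : i ≠ m) (hjk : j ≠ k)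
    (x : A.carrier) :
    subst A i k (subst A j m x) = subst A j m (subst A i k x) := by
  calc A.c i (A.d i k ⊓ A.c j (A.d j m ⊓ x))
      = A.c i (A.c j (A.d j m ⊓ x ⊓ A.d i k)) := by
        rw [c_inf_of_fixed hA _ (fixed_d hA hij.symm hjk), inf_comm]
    _ = A.c j (A.c i (A.d i k ⊓ x ⊓ A.d j m)) := by
        rw [c_comm hA, inf_assoc, inf_comm (A.d j m), inf_comm x]
    _ = A.c j (A.d j m ⊓ A.c i (A.d i k ⊓ x)) := by
        rw [c_inf_of_fixed hA _ (fixed_d hA hij him), inf_comm]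

theorem substList_inf (hl : ∀ γ ∈ l, γ ≠ t γ) (x y : A.carrier) :
    substList A t l (x ⊓ y) = substList A t l x ⊓ substList A t l y := by
  induction l with
  | nil => rfl
  | cons γ l ih =>
    rw [substList, ih fun δ hδ => hl δ (List.mem_cons_of_mem _ hδ),
      subst_inf hA (hl γ List.mem_cons_self)]
    rfl

theorem substList_compl (hl : ∀ γ ∈ l, γ ≠ t γ) (x : A.carrier) :
    substList A t l xᶜ = (substList A t l x)ᶜ := by
  induction l with
  | nil => rfl
  | cons γ l ih =>
    rw [substList, ih fun δ hδ => hl δ (List.mem_cons_of_mem _ hδ),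
      subst_compl hA (hl γ List.mem_cons_self)]
    rfl

theorem substList_of_fixed (hl : ∀ γ ∈ l, γ ≠ t γ) {x : A.carrier}
    (hx : ∀ γ ∈ l, A.c γ x = x) : substList A t l x = x := by
  induction l with
  | nil => rfl
  | cons γ l ih =>
    rw [substList, ih (fun δ hδ => hl δ (List.mem_cons_of_mem _ hδ))
      (fun δ hδ => hx δ (List.mem_cons_of_mem _ hδ)),
      subst_of_fixed hA (hl γ List.mem_cons_self) (hx γ List.mem_cons_self)]

theorem substList_erase [DecidableEq ι] (hl : ∀ γ ∈ l, t γ ∉ l) {γ : ι} (hγ : γ ∈ l)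
    (x : A.carrier) : substList A t l x = subst A γ (t γ) (substList A t (l.erase γ) x) := by
  have key : ∀ m : List ι, (∀ δ ∈ m, t δ ∉ l) → m ⊆ l → γ ∈ m →
      substList A t m x = subst A γ (t γ) (substList A t (m.erase γ) x) := by
    intro m
    induction m with
    | nil => intro _ _ h; exact absurd h List.not_mem_nil
    | cons δ m ih =>
      intro h1 h2 h3
      by_cases hδ : δ = γ
      · subst hδ
        rw [List.erase_cons_head]
        rfl
      · have h3' : γ ∈ m := (List.mem_cons.1 h3).resolve_left (Ne.symm hδ)
        rw [List.erase_cons_tail (by simpa using hδ), substList, substList,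
          ih (fun ε hε => h1 ε (List.mem_cons_of_mem _ hε))
            (fun ε hε => h2 (List.mem_cons_of_mem _ hε)) h3']
        refine subst_comm hA hδ (fun h => ?_) (fun h => ?_) _
        · exact hl γ hγ (h ▸ h2 List.mem_cons_self)
        · exact h1 δ List.mem_cons_self (h ▸ hγ)
  exact key l hl (fun _ h => h) hγ

theorem c_substList {γ : ι} (hγ : γ ∉ l) (ht : ∀ δ ∈ l, t δ ≠ γ) (x : A.carrier) :
    A.c γ (substList A t l x) = substList A t l (A.c γ x) := by
  induction l with
  | nil => rfl
  | cons δ l ih =>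
    rw [List.mem_cons, not_or] at hγ
    rw [substList, c_subst_of_ne hA hγ.1 (ht δ List.mem_cons_self).symm,
      ih hγ.2 fun ε hε => ht ε (List.mem_cons_of_mem _ hε)]
    rfl

theorem substList_d [DecidableEq ι] (hnd : l.Nodup) (hl : ∀ γ ∈ l, t γ ∉ l) {γ δ : ι}
    (hγ : γ ∈ l) (hδ : δ ∈ l) : substList A t l (A.d γ δ) = A.d (t γ) (t δ) := by
  have hne : ∀ ε ∈ l, ∀ ζ ∈ l, ε ≠ t ζ := fun ε hε ζ hζ h => hl ζ hζ (h ▸ hε)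
  by_cases hγδ : γ = δ
  · subst hγδ
    rw [d_self hA, d_self hA]
    exact substList_of_fixed hA (fun ε hε => hne ε hε ε hε) fun ε _ => c_top hA ε
  have hδ' : δ ∈ l.erase γ := (List.mem_erase_of_ne (Ne.symm hγδ)).2 hδ
  have hsub : ∀ ε ∈ l.erase γ, ε ∈ l := fun ε hε => List.mem_of_mem_erase hε
  rw [substList_erase hA hl hγ,
    substList_erase hA (fun ε hε h => hl ε (hsub ε hε) (hsub _ h)) hδ',
    substList_of_fixed hA, d_comm hA γ, subst_d hA (hne δ hδ δ hδ) (Ne.symm hγδ), d_comm hA,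
    subst_d hA (hne γ hγ γ hγ) (hne γ hγ δ hδ)]
  · intro ε hε
    have := hsub ε (List.mem_of_mem_erase hε)
    exact hne ε this ε this
  · intro ε hε
    rw [((hnd.erase γ).mem_erase_iff), hnd.mem_erase_iff] at hε
    exact fixed_d hA hε.2.1 hε.1

omit hA in
theorem substList_congr {t' : ι → ι} (h : ∀ γ ∈ l, t γ = t' γ) (x : A.carrier) :
    substList A t l x = substList A t' l x := by
  induction l with
  | nil => rfl
  | cons γ l ih =>
    rw [substList, substList, ih fun δ hδ => h δ (List.mem_cons_of_mem _ hδ),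
      h γ List.mem_cons_self]

omit hA in
theorem countable_substList {K : Set ι} (hK : K.Countable) (l : List ι) (x : A.carrier) :
    {y | ∃ t : ι → ι, (∀ γ, t γ ∈ K) ∧ y = substList A t l x}.Countable := by
  induction l with
  | nil => exact (Set.countable_singleton x).mono (by rintro y ⟨t, _, rfl⟩; rfl)
  | cons γ l ih =>
    refine (hK.biUnion fun k _ => ih.image (subst A γ k)).mono ?_
    rintro y ⟨t, ht, rfl⟩
    exact Set.mem_biUnion (ht γ) ⟨_, ⟨t, ht, rfl⟩, rfl⟩

theorem d_inf_subst_le {γ k m : ι} (hk : γ ≠ k) (hm : γ ≠ m) (x : A.carrier) :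
    A.d k m ⊓ subst A γ k x ≤ subst A γ m x := by
  have h : A.d γ k ⊓ A.d k m ≤ A.d γ m := by
    by_cases hkm : k = m
    · subst hkm
      exact inf_le_left
    · rw [← c_d_inf_d hA hk hm hkm]
      exact le_c hA _ _
  rw [subst, inf_comm, ← c_inf_of_fixed hA _ (fixed_d hA hk hm)]
  refine c_mono hA _ (le_inf (le_trans ?_ h) ?_)
  · exact le_inf (inf_le_left.trans inf_le_left) inf_le_right
  · exact inf_le_left.trans inf_le_right

end SubstList

/-! ### Completeness: locally finite algebras and set algebras -/

/-- A decreasing sequence of nonzero elements of a Boolean algebra lies in an ultrafilter. -/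
theorem exists_ultrafilter_of_antitone {α : Type*} [BooleanAlgebra α] (b : ℕ → α)
    (hb : Antitone b) (h0 : ∀ n, b n ≠ ⊥) :
    ∃ F : Set α, (∀ n, b n ∈ F) ∧ (∀ x y, x ⊓ y ∈ F ↔ x ∈ F ∧ y ∈ F) ∧
      (∀ x, xᶜ ∈ F ↔ x ∉ F) := by
  have hF : Order.IsPFilter {x | ∃ n, b n ≤ x} := by
    refine Order.IsPFilter.of_def ⟨b 0, 0, le_rfl⟩ ?_ ?_
    · rintro x ⟨m, hm⟩ y ⟨n, hn⟩
      exact ⟨b (max m n), ⟨_, le_rfl⟩, (hb (le_max_left m n)).trans hm,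
        (hb (le_max_right m n)).trans hn⟩
    · rintro x y hxy ⟨n, hn⟩
      exact ⟨n, hn.trans hxy⟩
  obtain ⟨J, hJ, -, hd⟩ := DistribLattice.prime_ideal_of_disjoint_filter_ideal
    (F := hF.toPFilter) (I := Order.Ideal.principal ⊥) (by
      rw [Set.disjoint_left]
      rintro x ⟨n, hn⟩ hx
      exact h0 n (le_bot_iff.1 (hn.trans (Order.Ideal.mem_principal.1 hx))))
  rw [Set.disjoint_left] at hd
  have htop : ⊤ ∉ J := fun h => hd ⟨0, le_top⟩ h
  refine ⟨{x | x ∉ J}, fun n => hd ⟨n, le_rfl⟩, fun x y => ?_, fun x => ?_⟩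
  · refine ⟨fun h => ⟨fun hx => h (J.lower inf_le_left hx), fun hy => h (J.lower inf_le_right hy)⟩,
      fun h hxy => ?_⟩
    exact (hJ.mem_or_mem hxy).elim h.1 h.2
  · refine ⟨fun h hx => hx ?_ , fun h hx => htop ?_⟩
    · exact hJ.mem_or_compl_mem.resolve_right h
    · rw [← sup_compl_eq_top (x := x)]
      exact J.sup_mem (not_not.1 h) hx

/-- A locally finite algebra has ultrafilters providing witnesses from a given infinite set `K` of
indices for countably many cylindrified elements: any `k ∈ K` on which neither `y` nor the element
`b` already in the filter depends may be used, as then `b ⊓ subst A γ k y = ⊥` implies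
`b ⊓ A.c γ y = ⊥`. -/
theorem exists_ultrafilter_witness (hA : A ∈ Lf ι) {K : Set ι} (hK : K.Infinite)
    (Y : ℕ → ι × A.carrier) {a : A.carrier} (ha : a ≠ ⊥) :
    ∃ F : Set A.carrier, a ∈ F ∧ (∀ x y, x ⊓ y ∈ F ↔ x ∈ F ∧ y ∈ F) ∧
      (∀ x, xᶜ ∈ F ↔ x ∉ F) ∧
      ∀ n, A.c (Y n).1 (Y n).2 ∈ F → ∃ k ∈ K, k ≠ (Y n).1 ∧ subst A (Y n).1 k (Y n).2 ∈ F := by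
  have hCA := hA.1
  have step : ∀ (n : ℕ) (b : {b : A.carrier // b ≠ ⊥}), ∃ b' : {b : A.carrier // b ≠ ⊥},
      b'.1 ≤ b.1 ∧ (b'.1 ≤ (A.c (Y n).1 (Y n).2)ᶜ ∨
        ∃ k ∈ K, k ≠ (Y n).1 ∧ b'.1 ≤ subst A (Y n).1 k (Y n).2) := by
    rintro n ⟨b, hb⟩
    obtain ⟨γ, y⟩ := Y n
    by_cases h0 : b ⊓ A.c γ y = ⊥
    · exact ⟨⟨b, hb⟩, le_rfl, Or.inl (le_compl_iff_disjoint_right.2 (disjoint_iff.2 h0))⟩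
    · obtain ⟨k, hkK, hk⟩ :=
        (hK.sdiff (((hA.2 b).union (hA.2 y)).union (Set.finite_singleton γ))).nonempty
      simp only [Set.mem_union, Set.mem_ofPred_eq, Set.mem_singleton_iff, not_or, not_not] at hk
      obtain ⟨⟨hkb, hky⟩, hkγ⟩ := hk
      refine ⟨⟨b ⊓ subst A γ k y, fun h => h0 ?_⟩, inf_le_left,
        Or.inr ⟨k, hkK, hkγ, inf_le_right⟩⟩
      have h1 := congrArg (A.c k) h
      rwa [inf_comm, c_inf_of_fixed hCA _ hkb, c_bot hCA,
        c_subst_of_fixed hCA (Ne.symm hkγ) hky, inf_comm] at h1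
  choose next hle hnext using step
  let b : ℕ → {b : A.carrier // b ≠ ⊥} := fun n => Nat.rec ⟨a, ha⟩ (fun n b => next n b) n
  obtain ⟨F, hbF, hinf, hcompl⟩ := exists_ultrafilter_of_antitone (fun n => (b n).1)
    (antitone_nat_of_succ_le fun n => hle n (b n)) fun n => (b n).2
  have hmono : ∀ x y, x ≤ y → x ∈ F → y ∈ F := fun x y hxy hx =>
    ((hinf x y).1 ((inf_eq_left.2 hxy).symm ▸ hx)).2
  refine ⟨F, hbF 0, hinf, hcompl, fun n hn => ?_⟩
  rcases hnext n (b n) with h | ⟨k, hk, hkγ, h⟩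
  · exact absurd hn ((hcompl _).1 (hmono _ _ h (hbF (n + 1))))
  · exact ⟨k, hk, hkγ, hmono _ _ h (hbF (n + 1))⟩

/-- The full set algebra on all sequences over `U`. -/
abbrev cartesian (ι U : Type u) : CylStruct ι := fullSetAlgebra (Set.univ : Set (ι → U))

theorem updateClosed_univ {U : Type u} : UpdateClosed (Set.univ : Set (ι → U)) :=
  fun _ _ _ _ _ => trivial

/-- The Henkin construction. The base consists of the classes of countably many indices outside
`Γ` modulo the diagonals in a suitable ultrafilter `F`, and an element `x` is sent to the set of
those assignments `t` for which the substitution of `t` into `x` belongs to `F`. -/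
theorem exists_map_cartesian [Infinite ι] (hA : A ∈ Lf ι) (Γ : Finset ι) {Φ : Set A.carrier}
    (hΦ : Φ.Finite) {a : A.carrier} (ha : a ≠ ⊥) (hfix : ∀ γ ∈ Γ, A.c γ a = a) :
    ∃ (U : Type u) (g : A.carrier → (cartesian ι U).carrier),
      (∀ x y, g (x ⊔ y) = g x ⊔ g y) ∧ (∀ x, g xᶜ = (g x)ᶜ) ∧
      (∀ γ ∈ Γ, ∀ x ∈ Φ, g (A.c γ x) = (cartesian ι U).c γ (g x)) ∧
      (∀ γ ∈ Γ, ∀ δ ∈ Γ, g (A.d γ δ) = (cartesian ι U).d γ δ) ∧ g a ≠ ⊥ := by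
  classical
  have hCA := hA.1
  -- A countable set of fresh indices, and the countably many conditions on the ultrafilter.
  have hΓ : (Γ : Set ι)ᶜ.Infinite := Γ.finite_toSet.infinite_compl
  let emb := hΓ.natEmbedding
  let K : Set ι := Set.range fun n => (emb n).1
  have hK : K.Infinite := Set.infinite_range_of_injective
    (Subtype.val_injective.comp emb.injective)
  have hKc : K.Countable := Set.countable_range _
  have hKΓ : ∀ k ∈ K, k ∉ Γ := by
    rintro _ ⟨n, rfl⟩
    exact (emb n).2
  let l := Γ.toList
  let S : Set (ι × A.carrier) := ⋃ γ ∈ Γ, ⋃ x ∈ Φ,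
    Prod.mk γ '' {y | ∃ t : ι → ι, (∀ δ, t δ ∈ K) ∧ y = substList A t (l.erase γ) x}
  have hS : S.Countable := Γ.countable_toSet.biUnion fun γ _ => hΦ.countable.biUnion fun x _ =>
    (countable_substList hKc _ x).image _
  obtain ⟨Y, hY⟩ := (hS.insert ((emb 0).1, ⊥)).exists_eq_range (Set.insert_nonempty _ _)
  obtain ⟨F, haF, hinf, hcompl, hwit⟩ := exists_ultrafilter_witness hA hK Y ha
  have hmono : ∀ x y, x ≤ y → x ∈ F → y ∈ F := fun x y hxy hx =>
    ((hinf x y).1 ((inf_eq_left.2 hxy).symm ▸ hx)).2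
  have htop : ⊤ ∈ F := hmono _ _ le_top haF
  have htrans : ∀ i j k : ι, A.d i j ∈ F → A.d j k ∈ F → A.d i k ∈ F := by
    intro i j k h1 h2
    by_cases hij : i = j
    · rwa [hij]
    by_cases hjk : j = k
    · rwa [← hjk]
    by_cases hik : i = k
    · rwa [hik, d_self hCA]
    refine hmono _ _ ?_ ((hinf _ _).2 ⟨h1, h2⟩)
    rw [← c_d_inf_d hCA hij hik hjk]
    exact le_c hCA _ _
  let E : Setoid K :=
    { r := fun k m => A.d k m ∈ F
      iseqv :=
        { refl := fun k => (d_self hCA k.1).symm ▸ htop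
          symm := fun {k m} h => (d_comm hCA k.1 m.1) ▸ h
          trans := fun {i j k} => htrans i j k } }
  let rep : (ι → Quotient E) → ι → ι := fun t i => (t i).out.1
  have hrepK : ∀ t i, rep t i ∈ K := fun t i => (t i).out.2
  have hrepl : ∀ t, ∀ γ ∈ l, rep t γ ∉ l := fun t γ _ h =>
    hKΓ _ (hrepK t γ) (Finset.mem_toList.1 h)
  have hrepne : ∀ t, ∀ γ ∈ l, γ ≠ rep t γ := fun t γ hγ h =>
    hrepl t γ hγ (h ▸ hγ)
  have herase : ∀ t γ x, γ ∈ Γ → (∀ δ, t δ ∈ K) →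
      substList A t l (A.c γ x) = A.c γ (substList A t (l.erase γ) x) := by
    intro t γ x hγ ht
    have htl : ∀ δ ∈ l, t δ ∉ l := fun δ _ h => hKΓ _ (ht δ) (Finset.mem_toList.1 h)
    have hγl : γ ∈ l := Finset.mem_toList.2 hγ
    rw [substList_erase hCA htl hγl, ← c_substList hCA (Γ.nodup_toList.not_mem_erase)
        (fun δ _ => ne_of_mem_of_not_mem (ht δ) fun h => hKΓ _ h hγ),
      subst_of_fixed hCA (ne_of_mem_of_not_mem hγ (hKΓ _ (ht γ))) (c_idem hCA _ _)]
  refine ⟨Quotient E, fun x => setAlgebraOf fun t => substList A (rep t.1) l x ∈ F, fun x y => ?_,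
    fun x => ?_, fun γ hγ x hx => ?_, fun γ hγ δ hδ => ?_, ?_⟩
  · refine SetLike.ext fun t => ?_
    simp only [mem_fullSetAlgebra_sup, mem_setAlgebraOf]
    have h := hrepne t.1
    rw [← compl_compl (x ⊔ y), compl_sup, substList_compl hCA h, substList_inf hCA h,
      substList_compl hCA h, substList_compl hCA h, hcompl, hinf, hcompl, hcompl]
    tauto
  · refine SetLike.ext fun t => ?_
    simp only [mem_fullSetAlgebra_compl, mem_setAlgebraOf]
    rw [substList_compl hCA (hrepne t.1), hcompl]
  · refine SetLike.ext fun t => ?_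
    simp only [mem_fullSetAlgebra_c_iff_update updateClosed_univ, mem_setAlgebraOf]
    have hγl : γ ∈ l := Finset.mem_toList.2 hγ
    have hupd : ∀ u, substList A (rep (Function.update t.1 γ u)) l x =
        subst A γ u.out.1 (substList A (rep t.1) (l.erase γ) x) := by
      intro u
      rw [substList_erase hCA (hrepl _) hγl]
      have h1 : rep (Function.update t.1 γ u) γ = u.out.1 := by simp [rep]
      rw [h1]
      congr 1
      refine substList_congr (fun δ hδ => ?_) x
      have hne : δ ≠ γ := (Γ.nodup_toList.mem_erase_iff.1 hδ).1
      simp [rep, Function.update_of_ne hne]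
    rw [herase _ γ x hγ (hrepK t.1)]
    simp only [hupd]
    constructor
    · intro h
      have hmem : (γ, substList A (rep t.1) (l.erase γ) x) ∈ insert ((emb 0).1, (⊥ : A.carrier)) S :=
        Or.inr (Set.mem_biUnion hγ (Set.mem_biUnion hx ⟨_, ⟨rep t.1, hrepK t.1, rfl⟩, rfl⟩))
      rw [hY] at hmem
      obtain ⟨n, hn⟩ := hmem
      have hw := hwit n
      rw [hn] at hw
      obtain ⟨k, hk, -, hkF⟩ := hw h
      refine ⟨Quotient.mk E ⟨k, hk⟩, ?_⟩
      -- The chosen representative of the class of `k` may differ from `k`.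
      have hout : A.d k (Quotient.mk E ⟨k, hk⟩).out.1 ∈ F :=
        E.symm (Quotient.mk_out (s := E) ⟨k, hk⟩)
      have hne : ∀ m ∈ K, γ ≠ m := fun m hm h => hKΓ m hm (h ▸ hγ)
      exact hmono _ _ (d_inf_subst_le hCA (hne k hk) (hne _ (Subtype.property _)) _)
        ((hinf _ _).2 ⟨hout, hkF⟩)
    · rintro ⟨u, hu⟩
      exact hmono _ _ (c_mono hCA _ inf_le_right) hu
  · refine SetLike.ext fun t => ?_
    simp only [mem_fullSetAlgebra_d, mem_setAlgebraOf]
    rw [substList_d hCA Γ.nodup_toList (hrepl t.1) (Finset.mem_toList.2 hγ)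
      (Finset.mem_toList.2 hδ)]
    exact Quotient.out_equiv_out (s := E)
  · rw [fullSetAlgebra_ne_bot_iff]
    refine ⟨⟨fun _ => Quotient.mk E ⟨_, Set.mem_range_self 0⟩, trivial⟩, ?_⟩
    rw [mem_setAlgebraOf]
    rwa [substList_of_fixed hCA (hrepne _) fun γ hγ => hfix γ (Finset.mem_toList.1 hγ)]

namespace CTerm

/-- The values of the subterms to which a cylindrification is applied. -/
def cylArgs (A : CylStruct ι) (v : ℕ → A.carrier) : CTerm ι → Set A.carrier
  | var _ => ∅
  | add s t => cylArgs A v s ∪ cylArgs A v t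
  | neg t => cylArgs A v t
  | cyl _ t => insert (t.eval A v) (cylArgs A v t)
  | diag _ _ => ∅

theorem cylArgs_finite (v : ℕ → A.carrier) (t : CTerm ι) : (t.cylArgs A v).Finite := by
  induction t with
  | var n => exact Set.finite_empty
  | add s t hs ht => exact hs.union ht
  | neg t ht => exact ht
  | cyl i t ht => exact ht.insert _
  | diag i j => exact Set.finite_empty

/-- A map that respects the operations only at the arguments that occur commutes with the
evaluation of a term. -/
theorem map_eval_of_cylArgs {Γ : Set ι} {g : A.carrier → B.carrier} {v : ℕ → A.carrier}
    (hsup : ∀ x y, g (x ⊔ y) = g x ⊔ g y) (hcompl : ∀ x, g xᶜ = (g x)ᶜ)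
    (hd : ∀ i ∈ Γ, ∀ j ∈ Γ, g (A.d i j) = B.d i j) (t : CTerm ι)
    (hc : ∀ i ∈ Γ, ∀ x ∈ t.cylArgs A v, g (A.c i x) = B.c i (g x)) (ht : t.ind ⊆ Γ) :
    g (t.eval A v) = t.eval B (fun n => g (v n)) := by
  induction t with
  | var n => rfl
  | add s t ihs iht =>
    rw [eval, hsup, ihs (fun i hi x hx => hc i hi x (Or.inl hx))
      (Set.subset_union_left.trans ht), iht (fun i hi x hx => hc i hi x (Or.inr hx))
      (Set.subset_union_right.trans ht)]
    rfl
  | neg t iht =>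
    rw [eval, hcompl, iht hc ht]
    rfl
  | cyl i t iht =>
    rw [eval, hc i (ht (Set.mem_insert _ _)) _ (Set.mem_insert _ _),
      iht (fun j hj x hx => hc j hj x (Or.inr hx)) ((Set.subset_insert _ _).trans ht)]
    rfl
  | diag i j => exact hd i (ht (by simp [ind])) j (ht (by simp [ind]))

/-- The cylindrification of a term at all indices in a list. -/
def cylList : List ι → CTerm ι → CTerm ι
  | [], t => t
  | i :: l, t => cyl i (cylList l t)

theorem ind_cylList (l : List ι) (t : CTerm ι) : (cylList l t).ind = {i | i ∈ l} ∪ t.ind := by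
  induction l with
  | nil => simp [cylList]
  | cons i l ih =>
    rw [cylList, ind, ih]
    ext j
    simp [or_assoc]

theorem le_eval_cylList (hA : A ∈ CA ι) (v : ℕ → A.carrier) (l : List ι) (t : CTerm ι) :
    t.eval A v ≤ (cylList l t).eval A v := by
  induction l with
  | nil => exact le_rfl
  | cons i l ih => exact ih.trans (le_c hA i _)

theorem eval_cylList_eq_bot (hA : A ∈ CA ι) {v : ℕ → A.carrier} (l : List ι) {t : CTerm ι}
    (h : t.eval A v = ⊥) : (cylList l t).eval A v = ⊥ := by
  induction l with
  | nil => exact h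
  | cons i l ih => rw [cylList, eval, ih, c_bot hA]

theorem c_eval_cylList (hA : A ∈ CA ι) (v : ℕ → A.carrier) {l : List ι} (t : CTerm ι) {i : ι}
    (hi : i ∈ l) : A.c i ((cylList l t).eval A v) = (cylList l t).eval A v := by
  induction l with
  | nil => exact absurd hi List.not_mem_nil
  | cons j l ih =>
    rcases List.mem_cons.1 hi with rfl | h
    · exact c_idem hA _ _
    · exact fixed_c_of_fixed hA j (ih h)

end CTerm

/-- An equation failing in a locally finite algebra fails in some Cartesian set algebra. -/
theorem exists_cartesian_not_models [Infinite ι] (hA : A ∈ Lf ι) {e : CEquation ι}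
    (he : ¬ Models A e) : ∃ U : Type u, ¬ Models (cartesian ι U) e := by
  simp only [Models, not_forall] at he
  obtain ⟨v, hv⟩ := he
  let Γ := e.ind_finite.toFinset
  let T := CTerm.cylList Γ.toList (CTerm.symmDiff e.lhs e.rhs)
  have hT : T.ind ⊆ Γ := by
    rw [CTerm.ind_cylList]
    refine Set.union_subset (fun i hi => Finset.mem_toList.1 hi) ?_
    simp [CTerm.symmDiff, CTerm.inf, CTerm.ind, Γ, CEquation.ind]
  obtain ⟨U, g, hsup, hcompl, hc, hd, hne⟩ := exists_map_cartesian hA Γ (T.cylArgs_finite v)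
    (a := T.eval A v)
    (fun h => hv (symmDiff_eq_bot.1 (by
      rw [← CTerm.eval_symmDiff, ← le_bot_iff]
      exact (CTerm.le_eval_cylList hA.1 v _ _).trans h.le)))
    (fun γ hγ => CTerm.c_eval_cylList hA.1 v _ (Finset.mem_toList.2 hγ))
  refine ⟨U, fun hU => hne ?_⟩
  rw [CTerm.map_eval_of_cylArgs (Γ := (Γ : Set ι)) hsup hcompl hd T hc hT]
  refine CTerm.eval_cylList_eq_bot (fullSetAlgebra_mem_CA updateClosed_univ) _ ?_
  rw [CTerm.eval_symmDiff, symmDiff_eq_bot]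
  exact hU _

/-! ### Local representability -/

namespace IsReductHom

variable {Γ : Set ι} {h : A.carrier → B.carrier}

theorem map_inf (hh : IsReductHom Γ A B h) (x y : A.carrier) : h (x ⊓ y) = h x ⊓ h y := by
  rw [← compl_compl (x ⊓ y), hh.map_compl, compl_inf, hh.map_sup, hh.map_compl, hh.map_compl,
    compl_sup, compl_compl, compl_compl]

theorem map_bot (hh : IsReductHom Γ A B h) : h ⊥ = ⊥ := by
  rw [← inf_compl_eq_bot (a := (⊥ : A.carrier)), hh.map_inf, hh.map_compl, inf_compl_eq_bot]

theorem map_symmDiff (hh : IsReductHom Γ A B h) (x y : A.carrier) :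
    h (symmDiff x y) = symmDiff (h x) (h y) := by
  rw [symmDiff_eq, symmDiff_eq, hh.map_sup, hh.map_inf, hh.map_inf, hh.map_compl, hh.map_compl]

theorem mono (hh : IsReductHom Γ A B h) {x y : A.carrier} (hxy : x ≤ y) : h x ≤ h y := by
  rw [← inf_eq_left, ← hh.map_inf, inf_eq_left.2 hxy]

end IsReductHom

/-- `A` is locally representable if for any finitely many indices and elements, and every nonzero
`a`, there is a map into a Cartesian set algebra not annihilating `a` that respects the operations
at the given indices and elements. -/
def LocallyRepresentable (A : CylStruct ι) : Prop :=
  ∀ (Γ : Finset ι) (Φ : Finset A.carrier) (a : A.carrier), a ≠ ⊥ →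
    ∃ (U : Type u) (f : A.carrier → (cartesian ι U).carrier),
      (∀ x ∈ Φ, ∀ y ∈ Φ, f (x ⊔ y) = f x ⊔ f y) ∧ (∀ x ∈ Φ, f xᶜ = (f x)ᶜ) ∧
      (∀ γ ∈ Γ, ∀ x ∈ Φ, f (A.c γ x) = (cartesian ι U).c γ (f x)) ∧
      (∀ γ ∈ Γ, ∀ δ ∈ Γ, f (A.d γ δ) = (cartesian ι U).d γ δ) ∧ f a ≠ ⊥

section Slice

variable {U : Type u} {V : Set (ι → U)}

open Classical in
/-- The sequence that agrees with `s` on `Γ` and with `t` elsewhere. -/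
noncomputable def splice (Γ : Finset ι) (t s : ι → U) : ι → U := fun i => if i ∈ Γ then s i else t i

theorem splice_self (Γ : Finset ι) (t : ι → U) : splice Γ t t = t := funext fun _ => ite_self _

theorem splice_empty (t s : ι → U) : splice ∅ t s = t :=
  funext fun i => if_neg (Finset.notMem_empty i)

theorem UpdateClosed.splice_mem (hV : UpdateClosed V) (Γ : Finset ι) {t : ι → U} (ht : t ∈ V)
    (s : ι → U) : splice Γ t s ∈ V := by
  classical
  induction Γ using Finset.induction_on with
  | empty => rwa [splice_empty]
  | insert i Γ hi ih =>
    refine hV _ ih i _ fun j hj => ?_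
    simp [splice, hj]

/-- The slice of a set of sequences through `t` in the directions in `Γ`. -/
noncomputable def slice (hV : UpdateClosed V) (Γ : Finset ι) (t : V)
    (X : (fullSetAlgebra V).carrier) : (cartesian ι U).carrier :=
  setAlgebraOf fun s => (⟨splice Γ t.1 s.1, hV.splice_mem Γ t.2 s.1⟩ : V) ∈ X

theorem isReductHom_slice (hV : UpdateClosed V) (Γ : Finset ι) (t : V) :
    IsReductHom (Γ : Set ι) (fullSetAlgebra V) (cartesian ι U) (slice hV Γ t) where
  map_sup _ _ := rfl
  map_compl _ := rfl
  map_c i hi X := by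
    classical
    refine SetLike.ext fun s => ?_
    have hs : ∀ u, splice Γ t.1 (Function.update s.1 i u) =
        Function.update (splice Γ t.1 s.1) i u := by
      intro u
      funext j
      by_cases hj : j = i
      · subst hj
        simp [splice, Finset.mem_coe.1 hi]
      · simp [splice, hj]
    simp only [slice, mem_fullSetAlgebra_c_iff_update updateClosed_univ, mem_setAlgebraOf,
      mem_fullSetAlgebra_c_iff_update hV, hs]
  map_d i hi j hj := by
    refine SetLike.ext fun s => ?_
    simp only [slice, mem_setAlgebraOf, mem_fullSetAlgebra_d, splice, if_pos (Finset.mem_coe.1 hi),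
      if_pos (Finset.mem_coe.1 hj)]

theorem slice_ne_bot (hV : UpdateClosed V) (Γ : Finset ι) {t : V}
    {X : (fullSetAlgebra V).carrier} (ht : t ∈ X) : slice hV Γ t X ≠ ⊥ := by
  rw [fullSetAlgebra_ne_bot_iff]
  refine ⟨⟨t.1, trivial⟩, ?_⟩
  rw [slice, mem_setAlgebraOf]
  convert! ht
  exact splice_self Γ t.1

theorem mem_eval_cylList (hV : UpdateClosed V) {v : ℕ → (fullSetAlgebra V).carrier}
    {t : CTerm ι} {s : V} (hs : s ∈ t.eval (fullSetAlgebra V) v) (l : List ι) {s' : V}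
    (h : ∀ i ∉ l, s'.1 i = s.1 i) : s' ∈ (CTerm.cylList l t).eval (fullSetAlgebra V) v := by
  classical
  induction l generalizing s' with
  | nil =>
    have : s' = s := Subtype.ext (funext fun i => h i List.not_mem_nil)
    exact this ▸ hs
  | cons i l ih =>
    rw [CTerm.cylList, CTerm.eval, mem_fullSetAlgebra_c_iff_update hV]
    refine ⟨s.1 i, ih fun j hj => ?_⟩
    by_cases hji : j = i
    · subst hji
      simp
    · simp only [Function.update_of_ne hji]
      exact h j (by simp [hji, hj])

/-- Any subalgebra of a full set algebra whose unit is closed under changing one coordinate is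
locally representable by slices. -/
theorem locallyRepresentable_of_injective (hV : UpdateClosed V)
    {h : A.carrier → (fullSetAlgebra V).carrier} (hh : IsReductHom Set.univ A (fullSetAlgebra V) h)
    (hinj : Function.Injective h) : LocallyRepresentable A := by
  intro Γ Φ a ha
  have hha : h a ≠ ⊥ := fun h0 => ha (hinj (h0.trans hh.map_bot.symm))
  obtain ⟨t, ht⟩ := fullSetAlgebra_ne_bot_iff.1 hha
  have hs := isReductHom_slice hV Γ t
  refine ⟨U, fun x => slice hV Γ t (h x), fun x _ y _ => ?_, fun x _ => ?_, fun γ hγ x _ => ?_,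
    fun γ hγ δ hδ => ?_, slice_ne_bot hV Γ ht⟩
  · exact (congrArg _ (hh.map_sup x y)).trans (hs.map_sup _ _)
  · exact (congrArg _ (hh.map_compl x)).trans (hs.map_compl _)
  · exact (congrArg _ (hh.map_c γ trivial x)).trans (hs.map_c γ hγ _)
  · exact (congrArg _ (hh.map_d γ trivial δ trivial)).trans (hs.map_d γ hγ δ hδ)

end Slice

/-- A finite set of equations has a term whose value bounds the differences of the two sides of all
these equations, and is zero when the equations hold. -/
theorem exists_term_failure (Γ : Set ι) {D : Set (CEquation ι)} (hD : D.Finite)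
    (hind : ∀ e ∈ D, e.ind ⊆ Γ) : ∃ ε : CTerm ι, ε.ind ⊆ Γ ∧
      ∀ (A : CylStruct ι) (v : ℕ → A.carrier),
        (∀ e ∈ D, symmDiff (e.lhs.eval A v) (e.rhs.eval A v) ≤ ε.eval A v) ∧
        ((∀ e ∈ D, e.lhs.eval A v = e.rhs.eval A v) → ε.eval A v = ⊥) := by
  induction D, hD using Set.Finite.induction_on with
  | empty =>
    refine ⟨.neg .top, by simp [CTerm.top, CTerm.ind], fun A v => ⟨by simp, fun _ => ?_⟩⟩
    rw [CTerm.eval, CTerm.eval_top, compl_top]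
  | @insert e D _ _ ih =>
    obtain ⟨ε, hε, h⟩ := ih fun e' he' => hind e' (Or.inr he')
    have he := hind e (Or.inl rfl)
    refine ⟨.add (.symmDiff e.lhs e.rhs) ε, ?_, fun A v => ⟨?_, fun hv => ?_⟩⟩
    · have h1 : e.lhs.ind ⊆ Γ := Set.subset_union_left.trans he
      have h2 : e.rhs.ind ⊆ Γ := Set.subset_union_right.trans he
      simp [CTerm.symmDiff, CTerm.inf, CTerm.ind, h1, h2, hε]
    · rw [CTerm.eval, CTerm.eval_symmDiff]
      rintro e' (rfl | he')
      · exact le_sup_left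
      · exact ((h A v).1 e' he').trans le_sup_right
    · rw [CTerm.eval, CTerm.eval_symmDiff, hv e (Or.inl rfl), symmDiff_self,
        (h A v).2 fun e' he' => hv e' (Or.inr he'), sup_bot_eq]

/-- Inductive algebras are locally representable: a finite part of `A` is described by the failing
equation `a ⊓ (c Γ ε)ᶜ = ⊥`, where `ε` collects the failures of the operation table of the part;
the equation fails in some locally finite algebra, hence in some Cartesian set algebra. -/
theorem locallyRepresentable_of_mem_Ret [Infinite ι] (hA : A ∈ Ret ι) :
    LocallyRepresentable A := by
  intro Γ Φ a ha
  obtain ⟨B, hB, hAB⟩ := exists_Lf_eqTheory_eq hA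
  -- A numbering of the elements that matter by variables.
  let Ψ : Set A.carrier := insert a ((Φ : Set A.carrier) ∪
    (Set.image2 (· ⊔ ·) (Φ : Set A.carrier) Φ ∪ ((·ᶜ) '' (Φ : Set A.carrier) ∪
      (Set.image2 A.c (Γ : Set ι) (Φ : Set A.carrier) ∪ Set.image2 A.d (Γ : Set ι) (Γ : Set ι)))))
  have hΨ : Ψ.Finite := by
    have h1 := Φ.finite_toSet
    have h2 := Γ.finite_toSet
    exact (h1.union ((h1.image2 _ h1).union ((h1.image _).union
      ((h2.image2 _ h1).union (h2.image2 _ h2))))).insert a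
  obtain ⟨w, hw⟩ := hΨ.countable.exists_eq_range ⟨a, Or.inl rfl⟩
  let N : A.carrier → ℕ := Function.invFun w
  have hN : ∀ x ∈ Ψ, w (N x) = x := fun x hx => Function.invFun_eq (by rwa [hw] at hx)
  have hNa : w (N a) = a := hN a (Or.inl rfl)
  have hNΦ : ∀ x ∈ Φ, w (N x) = x := fun x hx => hN x (Or.inr (Or.inl hx))
  have hNsup : ∀ x ∈ Φ, ∀ y ∈ Φ, w (N (x ⊔ y)) = x ⊔ y := fun x hx y hy =>
    hN _ (Or.inr (Or.inr (Or.inl ⟨x, hx, y, hy, rfl⟩)))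
  have hNcompl : ∀ x ∈ Φ, w (N xᶜ) = xᶜ := fun x hx =>
    hN _ (Or.inr (Or.inr (Or.inr (Or.inl ⟨x, hx, rfl⟩))))
  have hNc : ∀ γ ∈ Γ, ∀ x ∈ Φ, w (N (A.c γ x)) = A.c γ x := fun γ hγ x hx =>
    hN _ (Or.inr (Or.inr (Or.inr (Or.inr (Or.inl ⟨γ, hγ, x, hx, rfl⟩)))))
  have hNd : ∀ γ ∈ Γ, ∀ δ ∈ Γ, w (N (A.d γ δ)) = A.d γ δ := fun γ hγ δ hδ =>
    hN _ (Or.inr (Or.inr (Or.inr (Or.inr (Or.inr ⟨γ, hγ, δ, hδ, rfl⟩)))))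
  -- The operation table of the finite part.
  let D : Set (CEquation ι) :=
    Set.image2 (fun x y => ⟨.var (N (x ⊔ y)), .add (.var (N x)) (.var (N y))⟩)
      (Φ : Set A.carrier) Φ ∪
    ((fun x => ⟨.var (N xᶜ), .neg (.var (N x))⟩) '' (Φ : Set A.carrier) ∪
    (Set.image2 (fun γ x => ⟨.var (N (A.c γ x)), .cyl γ (.var (N x))⟩) (Γ : Set ι)
      (Φ : Set A.carrier) ∪
    Set.image2 (fun γ δ => ⟨.var (N (A.d γ δ)), .diag γ δ⟩) (Γ : Set ι) (Γ : Set ι)))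
  have hD : D.Finite := by
    have h1 := Φ.finite_toSet
    have h2 := Γ.finite_toSet
    exact (h1.image2 _ h1).union ((h1.image _).union ((h2.image2 _ h1).union (h2.image2 _ h2)))
  have hDind : ∀ e ∈ D, e.ind ⊆ (Γ : Set ι) := by
    rintro e (⟨x, hx, y, hy, rfl⟩ | ⟨x, hx, rfl⟩ | ⟨γ, hγ, x, hx, rfl⟩ | ⟨γ, hγ, δ, hδ, rfl⟩)
    · simp [CEquation.ind, CTerm.ind]
    · simp [CEquation.ind, CTerm.ind]
    · simpa [CEquation.ind, CTerm.ind] using hγ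
    · simpa [CEquation.ind, CTerm.ind, Set.insert_subset_iff] using ⟨hγ, hδ⟩
  have hDw : ∀ e ∈ D, e.lhs.eval A w = e.rhs.eval A w := by
    rintro e (⟨x, hx, y, hy, rfl⟩ | ⟨x, hx, rfl⟩ | ⟨γ, hγ, x, hx, rfl⟩ | ⟨γ, hγ, δ, hδ, rfl⟩)
    · simp only [CTerm.eval, hNsup x hx y hy, hNΦ x hx, hNΦ y hy]
    · simp only [CTerm.eval, hNcompl x hx, hNΦ x hx]
    · simp only [CTerm.eval, hNc γ hγ x hx, hNΦ x hx]
    · simp only [CTerm.eval, hNd γ hγ δ hδ]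
  obtain ⟨ε, hεind, hε⟩ := exists_term_failure (Γ : Set ι) hD hDind
  let e : CEquation ι := ⟨.inf (.var (N a)) (.neg (.cylList Γ.toList ε)), .neg .top⟩
  have heA : e ∉ EqTheory A := by
    intro he
    have h1 := he w
    simp only [e, CTerm.eval_inf, CTerm.eval, CTerm.eval_top, compl_top,
      CTerm.eval_cylList_eq_bot hA.1 _ ((hε A w).2 hDw), compl_bot, inf_top_eq, hNa] at h1
    exact ha h1
  rw [hAB] at heA
  obtain ⟨U, hU⟩ := exists_cartesian_not_models hB heA
  simp only [Models, not_forall] at hU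
  obtain ⟨v, hv⟩ := hU
  simp only [e, CTerm.eval_inf, CTerm.eval, CTerm.eval_top, compl_top] at hv
  obtain ⟨t, ht⟩ := fullSetAlgebra_ne_bot_iff.1 hv
  rw [mem_fullSetAlgebra_inf, mem_fullSetAlgebra_compl] at ht
  have hs := isReductHom_slice updateClosed_univ Γ t
  have hbot : slice updateClosed_univ Γ t (ε.eval _ v) = ⊥ := by
    by_contra h0
    obtain ⟨s, hs⟩ := fullSetAlgebra_ne_bot_iff.1 h0
    refine ht.2 (mem_eval_cylList updateClosed_univ hs _ fun i hi => ?_)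
    exact (if_neg fun h => hi (Finset.mem_toList.2 h)).symm
  have key : ∀ e' ∈ D, slice updateClosed_univ Γ t (e'.lhs.eval _ v) =
      slice updateClosed_univ Γ t (e'.rhs.eval _ v) := by
    intro e' he'
    rw [← symmDiff_eq_bot, ← hs.map_symmDiff, ← le_bot_iff, ← hbot]
    exact hs.mono ((hε _ v).1 e' he')
  refine ⟨U, fun x => slice updateClosed_univ Γ t (v (N x)), fun x hx y hy => ?_, fun x hx => ?_,
    fun γ hγ x hx => ?_, fun γ hγ δ hδ => ?_, slice_ne_bot _ Γ ht.1⟩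
  · exact (key _ (Or.inl ⟨x, hx, y, hy, rfl⟩)).trans (hs.map_sup _ _)
  · exact (key _ (Or.inr (Or.inl ⟨x, hx, rfl⟩))).trans (hs.map_compl _)
  · exact (key _ (Or.inr (Or.inr (Or.inl ⟨γ, hγ, x, hx, rfl⟩)))).trans (hs.map_c γ hγ _)
  · exact (key _ (Or.inr (Or.inr (Or.inr ⟨γ, hγ, δ, hδ, rfl⟩)))).trans (hs.map_d γ hγ δ hδ)

/-! ### From local representability to representability -/

open Filter in
/-- An ultraproduct of local representations represents the whole algebra. Every element `p` of
the ultraproduct gets one representing family `ch i p` per index `i`; the dependence on `i` allows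
the prescribed points `t j` of the local images of `a` to be represented by themselves at all
indices simultaneously. -/
theorem LocallyRepresentable.exists_hom (hA : LocallyRepresentable A) {a : A.carrier}
    (ha : a ≠ ⊥) : ∃ (U : Type u) (h : A.carrier → (cartesian ι U).carrier),
      IsReductHom Set.univ A (cartesian ι U) h ∧ h a ≠ ⊥ := by
  classical
  choose U f hsup hcompl hc hd hne using fun j : Finset ι × Finset A.carrier => hA j.1 j.2 a ha
  choose t ht using fun j => fullSetAlgebra_ne_bot_iff.1 (hne j)
  let F : Ultrafilter (Finset ι × Finset A.carrier) := Ultrafilter.of atTop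
  have hF : ∀ (Γ : Finset ι) (Φ : Finset A.carrier), ∀ᶠ j in (F : Filter _), (Γ, Φ) ≤ j :=
    fun Γ Φ => (Ultrafilter.of_le atTop) (eventually_ge_atTop _)
  let E : Setoid (∀ j, U j) := (F : Filter _).productSetoid U
  have hE : ∀ p q : ∀ j, U j, Quotient.mk E p = Quotient.mk E q ↔
      ∀ᶠ j in (F : Filter _), p j = q j := fun p q => Quotient.eq (r := E)
  let τ : ι → ∀ j, U j := fun i j => (t j).1 i
  let ch : ι → Quotient E → ∀ j, U j := fun i p => if p = Quotient.mk E (τ i) then τ i else p.out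
  have hch : ∀ i p, Quotient.mk E (ch i p) = p := by
    intro i p
    by_cases h : p = Quotient.mk E (τ i)
    · simp only [ch]
      rw [if_pos h, h]
    · simp only [ch, if_neg h, Quotient.out_eq]
  let pt : (ι → Quotient E) → ∀ j, (Set.univ : Set (ι → U j)) := fun s j =>
    ⟨fun i => ch i (s i) j, trivial⟩
  refine ⟨Quotient E, fun x => setAlgebraOf fun s => ∀ᶠ j in (F : Filter _), pt s.1 j ∈ f j x,
    ⟨fun x y => ?_, fun x => ?_, fun i _ x => ?_, fun i _ k _ => ?_⟩, ?_⟩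
  · refine SetLike.ext fun s => ?_
    simp only [mem_setAlgebraOf, mem_fullSetAlgebra_sup]
    rw [← Ultrafilter.eventually_or]
    refine eventually_congr ?_
    filter_upwards [hF ∅ {x, y}] with j hj
    rw [hsup j x (hj.2 (by simp)) y (hj.2 (by simp)), mem_fullSetAlgebra_sup]
  · refine SetLike.ext fun s => ?_
    simp only [mem_setAlgebraOf, mem_fullSetAlgebra_compl]
    rw [← Ultrafilter.eventually_not]
    refine eventually_congr ?_
    filter_upwards [hF ∅ {x}] with j hj
    rw [hcompl j x (hj.2 (by simp)), mem_fullSetAlgebra_compl]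
  · refine SetLike.ext fun s => ?_
    simp only [mem_setAlgebraOf, mem_fullSetAlgebra_c_iff_update updateClosed_univ]
    have h1 : (∀ᶠ j in (F : Filter _), pt s.1 j ∈ f j (A.c i x)) ↔
        ∀ᶠ j in (F : Filter _), ∃ u, (⟨Function.update (pt s.1 j).1 i u, trivial⟩ :
          (Set.univ : Set (ι → U j))) ∈ f j x := by
      refine eventually_congr ?_
      filter_upwards [hF {i} {x}] with j hj
      rw [hc j i (hj.1 (by simp)) x (hj.2 (by simp)),
        mem_fullSetAlgebra_c_iff_update updateClosed_univ]
    have h2 : ∀ p j, pt (Function.update s.1 i p) j =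
        ⟨Function.update (pt s.1 j).1 i (ch i p j), trivial⟩ := by
      intro p j
      refine Subtype.ext (funext fun k => ?_)
      by_cases hk : k = i
      · subst hk
        simp [pt]
      · simp [pt, hk]
    rw [h1]
    simp only [h2]
    constructor
    · intro h
      have h3 : ∀ j, ∃ u : U j, (∃ u, (⟨Function.update (pt s.1 j).1 i u, trivial⟩ :
          (Set.univ : Set (ι → U j))) ∈ f j x) → (⟨Function.update (pt s.1 j).1 i u, trivial⟩ :
          (Set.univ : Set (ι → U j))) ∈ f j x := by
        intro j
        by_cases hj : ∃ u, (⟨Function.update (pt s.1 j).1 i u, trivial⟩ :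
          (Set.univ : Set (ι → U j))) ∈ f j x
        · exact ⟨hj.choose, fun _ => hj.choose_spec⟩
        · exact ⟨(t j).1 i, fun h => absurd h hj⟩
      choose q hq using h3
      refine ⟨Quotient.mk E q, ?_⟩
      filter_upwards [h, (hE _ _).1 (hch i (Quotient.mk E q))] with j hj hj'
      rw [hj']
      exact hq j hj
    · rintro ⟨p, hp⟩
      filter_upwards [hp] with j hj
      exact ⟨_, hj⟩
  · refine SetLike.ext fun s => ?_
    simp only [mem_setAlgebraOf, mem_fullSetAlgebra_d]
    rw [← hch i (s.1 i), ← hch k (s.1 k), hE]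
    refine eventually_congr ?_
    filter_upwards [hF {i, k} ∅] with j hj
    rw [hd j i (hj.1 (by simp)) k (hj.1 (by simp)), mem_fullSetAlgebra_d]
  · rw [fullSetAlgebra_ne_bot_iff]
    refine ⟨⟨fun i => Quotient.mk E (τ i), trivial⟩, ?_⟩
    rw [mem_setAlgebraOf]
    refine Eventually.of_forall fun j => ?_
    have : pt (fun i => Quotient.mk E (τ i)) j = t j := by
      refine Subtype.ext (funext fun i => ?_)
      simp [pt, ch, τ]
    rw [this]
    exact ht j

/-- An algebra with enough homomorphisms into Cartesian set algebras is representable, over the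
disjoint union of their bases. -/
theorem LocallyRepresentable.mem_RCA [Infinite ι] (hA : LocallyRepresentable A) : A ∈ RCA ι := by
  choose U h hh hne using fun a : {a : A.carrier // a ≠ ⊥} => hA.exists_hom a.2
  let mk : ∀ a, U a → Σ a, U a := Sigma.mk
  let S : Set (Set (Σ a, U a)) := Set.range fun a => Set.range (mk a)
  let V : Set (ι → Σ a, U a) := ⋃ W ∈ S, space ι W
  have hmkV : ∀ a (t : ι → U a), mk a ∘ t ∈ V := fun a t =>
    Set.mem_biUnion (⟨a, rfl⟩ : Set.range (mk a) ∈ S) fun i => ⟨t i, rfl⟩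
  have hV : ∀ s ∈ V, ∃ a, ∃ t : ι → U a, s = mk a ∘ t := by
    intro s hs
    obtain ⟨_, ⟨a, rfl⟩, hs⟩ := Set.mem_iUnion₂.1 hs
    choose t ht using hs
    exact ⟨a, t, funext fun i => (ht i).symm⟩
  obtain ⟨i₀⟩ : Nonempty ι := inferInstance
  have hinj : ∀ {a b} {i : ι} {t : ι → U a} {t' : ι → U b},
      (mk a ∘ t) i = (mk b ∘ t') i → a = b := fun h => congrArg Sigma.fst h
  have hinj' : ∀ {a} {i : ι} {t t' : ι → U a}, (mk a ∘ t) i = (mk a ∘ t') i → t i = t' i :=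
    fun h => eq_of_heq (Sigma.mk.inj h).2
  let H : A.carrier → (fullSetAlgebra V).carrier := fun x => setAlgebraOf fun s =>
    ∃ a, ∃ t : ι → U a, s.1 = mk a ∘ t ∧ (⟨t, trivial⟩ : (Set.univ : Set (ι → U a))) ∈ h a x
  have hH : ∀ a (t : ι → U a) x, (⟨mk a ∘ t, hmkV a t⟩ : V) ∈ H x ↔
      (⟨t, trivial⟩ : (Set.univ : Set (ι → U a))) ∈ h a x := by
    intro a t x
    refine ⟨?_, fun ht => ⟨a, t, rfl, ht⟩⟩
    rintro ⟨b, t', ht', hx⟩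
    obtain rfl := hinj (congrFun ht' i₀)
    obtain rfl : t = t' := funext fun i => hinj' (congrFun ht' i)
    exact hx
  refine ⟨Σ a, U a, S, ?_, H, ⟨fun x y => ?_, fun x => ?_, fun i _ x => ?_, fun i _ j _ => ?_⟩,
    fun x y hxy => ?_⟩
  · rintro _ ⟨a, rfl⟩ _ ⟨b, rfl⟩ hab
    refine Set.disjoint_left.2 fun s hs hs' => hab ?_
    obtain ⟨u, hu⟩ := hs i₀
    obtain ⟨u', hu'⟩ := hs' i₀
    have : a = b := congrArg Sigma.fst (hu.trans hu'.symm)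
    rw [this]
  · refine SetLike.ext ?_
    rintro ⟨s, hs⟩
    obtain ⟨a, t, rfl⟩ := hV s hs
    rw [mem_fullSetAlgebra_sup, hH, hH, hH, (hh a).map_sup, mem_fullSetAlgebra_sup]
  · refine SetLike.ext ?_
    rintro ⟨s, hs⟩
    obtain ⟨a, t, rfl⟩ := hV s hs
    rw [mem_fullSetAlgebra_compl, hH, hH, (hh a).map_compl, mem_fullSetAlgebra_compl]
  · refine SetLike.ext ?_
    rintro ⟨s, hs⟩
    obtain ⟨a, t, rfl⟩ := hV s hs
    rw [mem_fullSetAlgebra_c, hH, (hh a).map_c i trivial, mem_fullSetAlgebra_c]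
    constructor
    · rintro ⟨⟨t', _⟩, ht', heq⟩
      exact ⟨⟨mk a ∘ t', hmkV a t'⟩, (hH a t' x).2 ht', fun j hj => congrArg (mk a) (heq j hj)⟩
    · rintro ⟨⟨s', hs'⟩, hx, heq⟩
      obtain ⟨b, t', rfl⟩ := hV s' hs'
      obtain ⟨k, hk⟩ := exists_ne i
      obtain rfl := hinj (heq k hk)
      exact ⟨⟨t', trivial⟩, (hH _ t' x).1 hx, fun j hj => hinj' (heq j hj)⟩
  · refine SetLike.ext ?_
    rintro ⟨s, hs⟩
    obtain ⟨a, t, rfl⟩ := hV s hs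
    rw [hH, (hh a).map_d i trivial j trivial, mem_fullSetAlgebra_d, mem_fullSetAlgebra_d]
    exact ⟨congrArg (mk a), fun h => eq_of_heq (Sigma.mk.inj h).2⟩
  · by_contra hne'
    have h0 : symmDiff x y ≠ ⊥ := fun h => hne' (symmDiff_eq_bot.1 h)
    refine hne ⟨_, h0⟩ ?_
    rw [(hh _).map_symmDiff, symmDiff_eq_bot]
    refine SetLike.ext ?_
    rintro ⟨t, _⟩
    rw [← hH _ t x, ← hH _ t y, hxy]

theorem Ret_subset_RCA [Infinite ι] : Ret ι ⊆ RCA ι := fun _ hA =>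
  (locallyRepresentable_of_mem_Ret hA).mem_RCA

/-! ### Algebras of invariant sets -/

section Invariant

variable {U : Type u} {V : Set (ι → U)}

/-- A symmetric relation `E` on `V` for which changes of related sequences at an index can be
matched, and which preserves the coincidences between coordinates. -/
structure IsBisimulation (E : V → V → Prop) : Prop where
  symm : ∀ s t, E s t → E t s
  zig : ∀ s t, E s t → ∀ (i : ι) (s' : V), (∀ j, j ≠ i → s.1 j = s'.1 j) →
    ∃ t' : V, E s' t' ∧ ∀ j, j ≠ i → t.1 j = t'.1 j
  diag : ∀ s t, E s t → ∀ i j, s.1 i = s.1 j → t.1 i = t.1 j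

variable {E : V → V → Prop}

/-- The sets of sequences that are invariant under a relation. -/
def invariantSets (E : V → V → Prop) : BooleanSubalgebra (fullSetAlgebra V).carrier where
  carrier := {X | ∀ s t, E s t → (s ∈ X ↔ t ∈ X)}
  supClosed' _ hX _ hY s t h := or_congr (hX s t h) (hY s t h)
  infClosed' _ hX _ hY s t h := and_congr (hX s t h) (hY s t h)
  compl_mem' hX s t h := not_congr (hX s t h)
  bot_mem' _ _ _ := Iff.rfl

theorem mem_invariantSets {X : (fullSetAlgebra V).carrier} :
    X ∈ invariantSets E ↔ ∀ s t, E s t → (s ∈ X ↔ t ∈ X) := Iff.rfl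

theorem IsBisimulation.c_mem (hE : IsBisimulation E) (i : ι) (X : (fullSetAlgebra V).carrier)
    (hX : X ∈ invariantSets E) : (fullSetAlgebra V).c i X ∈ invariantSets E := by
  have key : ∀ s t, E s t → s ∈ (fullSetAlgebra V).c i X → t ∈ (fullSetAlgebra V).c i X := by
    rintro s t h ⟨s', hs', heq⟩
    obtain ⟨t', ht', heq'⟩ := hE.zig s t h i s' heq
    exact ⟨t', (mem_invariantSets.1 hX s' t' ht').1 hs', heq'⟩
  exact fun s t h => ⟨key s t h, key t s (hE.symm s t h)⟩

theorem IsBisimulation.d_mem (hE : IsBisimulation E) (i j : ι) :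
    (fullSetAlgebra V).d i j ∈ invariantSets E :=
  fun s t h => ⟨hE.diag s t h i j, hE.diag t s (hE.symm s t h) i j⟩

/-- The algebra of the sets of sequences that are invariant under a bisimulation. -/
def invariantAlgebra (hE : IsBisimulation E) : CylStruct ι :=
  restrict (fullSetAlgebra V) (invariantSets E) hE.c_mem hE.d_mem

theorem invariantAlgebra_mem_CA (hV : UpdateClosed V) (hE : IsBisimulation E) :
    invariantAlgebra hE ∈ CA ι :=
  mem_CA_of_eqTheory_subset (fullSetAlgebra_mem_CA hV) eqTheory_subset_restrict

/-- The underlying set of sequences of an element of the invariant algebra. -/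
def toSet {hE : IsBisimulation E} (X : (invariantAlgebra hE).carrier) :
    (fullSetAlgebra V).carrier := X.1

theorem toSet_injective {hE : IsBisimulation E} :
    Function.Injective (toSet : (invariantAlgebra hE).carrier → _) := Subtype.val_injective

theorem mem_toSet_iff {hE : IsBisimulation E} (X : (invariantAlgebra hE).carrier) {s t : V}
    (h : E s t) : s ∈ toSet X ↔ t ∈ toSet X := X.2 s t h

theorem isReductHom_toSet {hE : IsBisimulation E} (Γ : Set ι) :
    IsReductHom Γ (invariantAlgebra hE) (fullSetAlgebra V) toSet := isReductHom_val Γ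

end Invariant

/-! ### A symmetric representable algebra that is not inductive -/

open Classical in
/-- Finite permutations of sign one: those arising from an even permutation of any sufficiently
large finite set. -/
def evenPerm (ι : Type u) : Subgroup (Equiv.Perm ι) where
  carrier := {g | ∃ F : Finset ι, ∀ F' : Finset ι, F ⊆ F' → ∃ h : Equiv.Perm {x // x ∈ F'},
    Equiv.Perm.sign h = 1 ∧ Equiv.Perm.ofSubtype h = g}
  mul_mem' := by
    rintro g g' ⟨F, hF⟩ ⟨F₂, hF₂⟩
    refine ⟨F ∪ F₂, fun F' hF' => ?_⟩
    obtain ⟨h, h1, h2⟩ := hF F' (Finset.subset_union_left.trans hF')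
    obtain ⟨h', h1', h2'⟩ := hF₂ F' (Finset.subset_union_right.trans hF')
    exact ⟨h * h', by rw [Equiv.Perm.sign_mul, h1, h1', one_mul], by rw [map_mul, h2, h2']⟩
  one_mem' := ⟨∅, fun F' _ => ⟨1, Equiv.Perm.sign_one, map_one _⟩⟩
  inv_mem' := by
    rintro g ⟨F, hF⟩
    refine ⟨F, fun F' hF' => ?_⟩
    obtain ⟨h, h1, h2⟩ := hF F' hF'
    exact ⟨h⁻¹, by rw [Equiv.Perm.sign_inv, h1], by rw [map_inv, h2]⟩

open Classical in
theorem swap_mul_swap_mem_evenPerm {a b d : ι} (hab : a ≠ b) (hbd : b ≠ d) :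
    Equiv.swap a b * Equiv.swap b d ∈ evenPerm ι := by
  refine ⟨{a, b, d}, fun F' hF' => ?_⟩
  have ha : a ∈ F' := hF' (by simp)
  have hb : b ∈ F' := hF' (by simp)
  have hd : d ∈ F' := hF' (by simp)
  refine ⟨Equiv.swap ⟨a, ha⟩ ⟨b, hb⟩ * Equiv.swap ⟨b, hb⟩ ⟨d, hd⟩, ?_, ?_⟩
  · rw [Equiv.Perm.sign_mul, Equiv.Perm.sign_swap (by simpa using hab),
      Equiv.Perm.sign_swap (by simpa using hbd)]
    rfl
  · rw [map_mul, Equiv.Perm.ofSubtype_swap_eq, Equiv.Perm.ofSubtype_swap_eq]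

open Classical in
theorem swap_notMem_evenPerm {a b : ι} (hab : a ≠ b) : Equiv.swap a b ∉ evenPerm ι := by
  rintro ⟨F, hF⟩
  obtain ⟨h, h1, h2⟩ := hF (F ∪ {a, b}) Finset.subset_union_left
  have ha : a ∈ F ∪ {a, b} := by simp
  have hb : b ∈ F ∪ {a, b} := by simp
  rw [← Equiv.Perm.ofSubtype_swap_eq ⟨a, ha⟩ ⟨b, hb⟩] at h2
  rw [Equiv.Perm.ofSubtype_injective h2, Equiv.Perm.sign_swap (by simpa using hab)] at h1
  exact absurd h1 (by decide)

/-- The sequences of indices that agree with a permutation at all but finitely many places. -/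
def almostPerm (ι : Type u) : Set (ι → ι) := {s | ∃ π : Equiv.Perm ι, {i | s i ≠ π i}.Finite}

theorem updateClosed_almostPerm : UpdateClosed (almostPerm ι) := by
  rintro s ⟨π, hπ⟩ i t ht
  refine ⟨π, (hπ.insert i).subset fun j hj => ?_⟩
  by_cases hji : j = i
  · exact Or.inl hji
  · exact Or.inr fun h => hj ((ht j hji).trans h)

theorem comp_mem_almostPerm {s : ι → ι} (hs : s ∈ almostPerm ι) (g : Equiv.Perm ι) :
    g ∘ s ∈ almostPerm ι := by
  obtain ⟨π, hπ⟩ := hs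
  exact ⟨g * π, hπ.subset fun i hi h => hi (congrArg g h)⟩

theorem mem_almostPerm_comp {s : ι → ι} (hs : s ∈ almostPerm ι) (ρ : Equiv.Perm ι) :
    s ∘ ρ ∈ almostPerm ι := by
  obtain ⟨π, hπ⟩ := hs
  exact ⟨π * ρ, hπ.preimage ρ.injective.injOn⟩

/-- Two sequences are related if they differ by an even permutation of the base. -/
def evenRel (s t : almostPerm ι) : Prop := ∃ g ∈ evenPerm ι, t.1 = g ∘ s.1

theorem isBisimulation_evenRel : IsBisimulation (evenRel (ι := ι)) where
  symm := by
    rintro s t ⟨g, hg, h⟩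
    refine ⟨g⁻¹, inv_mem hg, ?_⟩
    rw [h]
    funext i
    simp
  zig := by
    rintro s t ⟨g, hg, h⟩ i s' hs'
    refine ⟨⟨g ∘ s'.1, comp_mem_almostPerm s'.2 g⟩, ⟨g, hg, rfl⟩, fun j hj => ?_⟩
    rw [h]
    exact congrArg g (hs' j hj)
  diag := by
    rintro s t ⟨g, hg, h⟩ i j hij
    rw [h]
    exact congrArg g hij

/-- The algebra of the sets of sequences that are invariant under even permutations of the base. -/
abbrev evenAlgebra (ι : Type u) : CylStruct ι := invariantAlgebra (isBisimulation_evenRel (ι := ι))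

theorem evenAlgebra_mem_CA : evenAlgebra ι ∈ CA ι :=
  invariantAlgebra_mem_CA updateClosed_almostPerm _

theorem evenAlgebra_mem_RCA [Infinite ι] : evenAlgebra ι ∈ RCA ι :=
  (locallyRepresentable_of_injective updateClosed_almostPerm (isReductHom_toSet _)
    toSet_injective).mem_RCA

/-- Permuting the coordinates of the sequences is an automorphism up to renaming the indices. -/
def evenAlgebraPerm (ρ : Equiv.Perm ι) (X : (evenAlgebra ι).carrier) : (evenAlgebra ι).carrier :=
  ⟨setAlgebraOf fun s => (⟨s.1 ∘ ρ, mem_almostPerm_comp s.2 ρ⟩ : almostPerm ι) ∈ toSet X, by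
    rintro s t ⟨g, hg, h⟩
    refine mem_toSet_iff X ⟨g, hg, ?_⟩
    simp only [h]
    rfl⟩

theorem eval_rename_evenAlgebra (ρ : Equiv.Perm ι) (v : ℕ → (evenAlgebra ι).carrier)
    (t : CTerm ι) : (t.rename ρ).eval (evenAlgebra ι) (fun n => evenAlgebraPerm ρ (v n)) =
      evenAlgebraPerm ρ (t.eval (evenAlgebra ι) v) := by
  induction t with
  | var n => rfl
  | add s t hs ht =>
    rw [CTerm.rename, CTerm.eval, hs, ht]
    rfl
  | neg t ht =>
    rw [CTerm.rename, CTerm.eval, ht]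
    rfl
  | cyl i t ht =>
    rw [CTerm.rename, CTerm.eval, ht]
    refine toSet_injective (SetLike.ext fun s => ?_)
    constructor
    · rintro ⟨s', hs', h⟩
      exact ⟨⟨s'.1 ∘ ρ, mem_almostPerm_comp s'.2 ρ⟩, hs',
        fun j hj => h (ρ j) fun h => hj (ρ.injective h)⟩
    · rintro ⟨s', hs', h⟩
      refine ⟨⟨s'.1 ∘ ρ.symm, mem_almostPerm_comp s'.2 ρ.symm⟩, ?_, fun j hj => ?_⟩
      · change (⟨(s'.1 ∘ ρ.symm) ∘ ρ, _⟩ : almostPerm ι) ∈ toSet _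
        convert! hs'
        funext j
        simp
      · have := h (ρ.symm j) fun h => hj (by rw [← h, ρ.apply_symm_apply])
        simpa using this
  | diag i j => rfl

/-- Renaming the indices corresponds to permuting the coordinates of the sequences. -/
theorem evenAlgebra_mem_Sy : evenAlgebra ι ∈ Sy ι := by
  refine ⟨evenAlgebra_mem_CA, fun e ρ he v => ?_⟩
  have hv : v = fun n => evenAlgebraPerm ρ (evenAlgebraPerm ρ.symm (v n)) := by
    funext n
    refine toSet_injective (SetLike.ext fun s => ?_)
    have : (⟨(s.1 ∘ ρ) ∘ ρ.symm, mem_almostPerm_comp (mem_almostPerm_comp s.2 ρ) ρ.symm⟩ :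
        almostPerm ι) = s := Subtype.ext (funext fun j => by simp)
    change s ∈ toSet (v n) ↔ (⟨(s.1 ∘ ρ) ∘ ρ.symm, _⟩ : almostPerm ι) ∈ toSet (v n)
    rw [this]
  rw [hv, CEquation.rename, eval_rename_evenAlgebra, eval_rename_evenAlgebra]
  exact congrArg _ (he _)

/-- For `i`, `j`, `k` distinct, `s` belongs to the value of this term iff there are two distinct
points `u`, `u'` of the base that no further point separates with respect to the binary relation
obtained from the value of `x₀` by fixing all coordinates except `i`, `k` as in `s` and
quantifying over the coordinate `j`. -/
def inseparable (i j k : ι) : CTerm ι :=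
  .cyl i (.cyl j (.inf (.neg (.diag i j)) (.neg (.cyl k (.inf
    (.inf (.neg (.diag i k)) (.neg (.diag j k)))
    (.symmDiff (.cyl j (.var 0)) (.cyl i (.inf (.diag i j) (.cyl j (.var 0))))))))))

theorem mem_eval_inseparable {U : Type u} {V : Set (ι → U)} (hV : UpdateClosed V) {i j k : ι}
    (hij : i ≠ j) (hik : i ≠ k) (hjk : j ≠ k) (v : ℕ → (fullSetAlgebra V).carrier) (s : V) :
    s ∈ (inseparable i j k).eval (fullSetAlgebra V) v ↔
      ∃ u u', u ≠ u' ∧ ∀ w, w ≠ u → w ≠ u' →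
        ((∃ x ∈ v 0, x.1 i = u ∧ x.1 k = w ∧ ∀ l, l ≠ i → l ≠ j → l ≠ k → x.1 l = s.1 l) ↔
          ∃ x ∈ v 0, x.1 i = u' ∧ x.1 k = w ∧ ∀ l, l ≠ i → l ≠ j → l ≠ k → x.1 l = s.1 l) := by
  classical
  have hupd : ∀ {l : ι} {X : (fullSetAlgebra V).carrier} {t : V},
      t ∈ (fullSetAlgebra V).c l X ↔
        ∃ u, (⟨Function.update t.1 l u, hV.update_mem t l u⟩ : V) ∈ X :=
    mem_fullSetAlgebra_c_iff_update hV
  let R : U → U → Prop := fun u w =>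
    ∃ x ∈ v 0, x.1 i = u ∧ x.1 k = w ∧ ∀ l, l ≠ i → l ≠ j → l ≠ k → x.1 l = s.1 l
  have hR : ∀ t : V, (∀ l, l ≠ i → l ≠ j → l ≠ k → t.1 l = s.1 l) →
      (t ∈ (fullSetAlgebra V).c j (v 0) ↔ R (t.1 i) (t.1 k)) := by
    intro t ht
    rw [mem_fullSetAlgebra_c]
    refine exists_congr fun x => and_congr_right fun _ => ⟨fun h => ?_, fun h l hl => ?_⟩
    · exact ⟨(h i hij).symm, (h k hjk.symm).symm,
        fun l h1 h2 h3 => (h l h2).symm.trans (ht l h1 h2 h3)⟩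
    · by_cases h1 : l = i
      · rw [h1, h.1]
      by_cases h3 : l = k
      · rw [h3, h.2.1]
      rw [h.2.2 l h1 hl h3, ht l h1 hl h3]
  have hR' : ∀ t : V, (∀ l, l ≠ i → l ≠ j → l ≠ k → t.1 l = s.1 l) →
      (t ∈ (fullSetAlgebra V).c i ((fullSetAlgebra V).d i j ⊓ (fullSetAlgebra V).c j (v 0)) ↔
        R (t.1 j) (t.1 k)) := by
    intro t ht
    rw [hupd]
    simp only [mem_fullSetAlgebra_inf, mem_fullSetAlgebra_d, Function.update_self,
      Function.update_of_ne hij.symm]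
    rw [exists_eq_left, hR]
    · simp only [Function.update_self, Function.update_of_ne hik.symm]
    · intro l h1 h2 h3
      exact (Function.update_of_ne h1 _ _).trans (ht l h1 h2 h3)
  simp only [inseparable, CTerm.eval, CTerm.eval_inf, CTerm.eval_symmDiff, symmDiff_eq]
  rw [hupd]
  refine exists_congr fun u => ?_
  rw [hupd]
  refine exists_congr fun u' => ?_
  rw [mem_fullSetAlgebra_inf, mem_fullSetAlgebra_compl, mem_fullSetAlgebra_compl,
    mem_fullSetAlgebra_d, hupd]
  simp only [Function.update_self, Function.update_of_ne hij]
  refine and_congr_right fun _ => ?_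
  rw [not_exists]
  refine forall_congr' fun w => ?_
  have ht : ∀ l, l ≠ i → l ≠ j → l ≠ k →
      Function.update (Function.update (Function.update s.1 i u) j u') k w l = s.1 l := by
    intro l h1 h2 h3
    rw [Function.update_of_ne h3, Function.update_of_ne h2, Function.update_of_ne h1]
  rw [mem_fullSetAlgebra_inf, mem_fullSetAlgebra_inf, mem_fullSetAlgebra_sup,
    mem_fullSetAlgebra_inf, mem_fullSetAlgebra_inf, mem_fullSetAlgebra_compl,
    mem_fullSetAlgebra_compl, mem_fullSetAlgebra_compl, mem_fullSetAlgebra_compl,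
    mem_fullSetAlgebra_d, mem_fullSetAlgebra_d, hR _ ht, hR' _ ht]
  simp only [Function.update_self, Function.update_of_ne hij, Function.update_of_ne hik,
    Function.update_of_ne hjk]
  change _ ↔ (w ≠ u → w ≠ u' → (R u w ↔ R u' w))
  rw [ne_comm (a := w), ne_comm (a := w)]
  generalize R u w = p
  generalize R u' w = q
  grind

/-- For a set that does not depend on `m`, points missed by a sequence outside `i`, `j`, `k`, `m`
are not separated: two of them are exchanged by an even permutation that also moves a third one. -/
theorem models_cylVars_inseparable {i j k m : ι} (hij : i ≠ j) (hik : i ≠ k) (hjk : j ≠ k)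
    (hmi : m ≠ i) (hmj : m ≠ j) (hmk : m ≠ k) :
    Models (evenAlgebra ι) ((⟨inseparable i j k, .top⟩ : CEquation ι).cylVars m) := by
  classical
  rw [models_cylVars_iff]
  intro v
  rw [CTerm.eval_top]
  refine toSet_injective (SetLike.ext fun s => ⟨fun _ => trivial, fun _ => ?_⟩)
  rw [CTerm.map_eval (isReductHom_toSet Set.univ) _ _ (Set.subset_univ _),
    mem_eval_inseparable updateClosed_almostPerm hij hik hjk]
  -- At least four points are not values of `s` outside `{i, j, k, m}`.
  obtain ⟨π, hπ⟩ := s.2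
  let F : Finset ι := hπ.toFinset ∪ {i, j, k, m}
  let I : Finset ι := {i, j, k, m}
  let M : Finset ι := F.image π \ (F \ I).image s.1
  have hM : ∀ u ∈ M, ∀ l ∉ I, s.1 l ≠ u := by
    intro u hu l hl h
    rw [Finset.mem_sdiff, Finset.mem_image, Finset.mem_image] at hu
    by_cases hlF : l ∈ F
    · exact hu.2 ⟨l, Finset.mem_sdiff.2 ⟨hlF, hl⟩, h⟩
    · obtain ⟨l', hl', h'⟩ := hu.1
      have h1 : s.1 l = π l := by
        by_contra hne
        exact hlF (Finset.mem_union_left _ (hπ.mem_toFinset.2 hne))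
      have : l' = l := π.injective (h'.trans (h.symm.trans h1))
      exact hlF (this ▸ hl')
  have hcard : 4 ≤ M.card := by
    have h1 : (F.image π).card = F.card := Finset.card_image_of_injective _ π.injective
    have h2 : ((F \ I).image s.1).card ≤ (F \ I).card := Finset.card_image_le
    have h3 : (F \ I).card + I.card = F.card :=
      Finset.card_sdiff_add_card_eq_card Finset.subset_union_right
    have h4 : I.card = 4 := by
      simp [I, Finset.card_insert_of_notMem, hij, hik, hjk, hmi.symm, hmj.symm, hmk.symm]
    have h5 := Finset.le_card_sdiff ((F \ I).image s.1) (F.image π)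
    change _ ≤ M.card at h5
    omega
  obtain ⟨u, hu, u', hu', huu'⟩ := Finset.one_lt_card.1 (by omega : 1 < M.card)
  have key : ∀ u ∈ M, ∀ u' ∈ M, u ≠ u' → ∀ w, w ≠ u → w ≠ u' →
      (∃ x ∈ toSet ((evenAlgebra ι).c m (v 0)), x.1 i = u ∧ x.1 k = w ∧
        ∀ l, l ≠ i → l ≠ j → l ≠ k → x.1 l = s.1 l) →
      ∃ x ∈ toSet ((evenAlgebra ι).c m (v 0)), x.1 i = u' ∧ x.1 k = w ∧
        ∀ l, l ≠ i → l ≠ j → l ≠ k → x.1 l = s.1 l := by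
    rintro u hu u' hu' huu' w hwu hwu' ⟨x, ⟨y, hy, hxy⟩, hxi, hxk, hx⟩
    obtain ⟨d, hd⟩ : (M \ {u, u', w}).Nonempty := by
      rw [← Finset.card_pos]
      have h1 := Finset.le_card_sdiff {u, u', w} M
      have h2 : ({u, u', w} : Finset ι).card ≤ 3 := Finset.card_le_three
      omega
    simp only [Finset.mem_sdiff, Finset.mem_insert, Finset.mem_singleton, not_or] at hd
    obtain ⟨hdM, hdu, hdu', hdw⟩ := hd
    let g : Equiv.Perm ι := Equiv.swap u u' * Equiv.swap u' d
    have hg : g ∈ evenPerm ι := swap_mul_swap_mem_evenPerm huu' (Ne.symm hdu')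
    have hgz : ∀ z, z ≠ u → z ≠ u' → z ≠ d → g z = z := by
      intro z h1 h2 h3
      rw [Equiv.Perm.mul_apply, Equiv.swap_apply_of_ne_of_ne h2 h3,
        Equiv.swap_apply_of_ne_of_ne h1 h2]
    have hgu : g u = u' := by
      rw [Equiv.Perm.mul_apply, Equiv.swap_apply_of_ne_of_ne huu' (Ne.symm hdu),
        Equiv.swap_apply_left]
    let y' : almostPerm ι := ⟨g ∘ y.1, comp_mem_almostPerm y.2 g⟩
    have hy' : y' ∈ toSet (v 0) := (mem_toSet_iff (v 0) ⟨g, hg, rfl⟩).1 hy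
    refine ⟨⟨_, updateClosed_almostPerm.update_mem y' m (s.1 m)⟩,
      ⟨y', hy', fun l hl => Function.update_of_ne hl _ _⟩, ?_, ?_, fun l h1 h2 h3 => ?_⟩
    · refine (Function.update_of_ne hmi.symm _ _).trans ?_
      change g (y.1 i) = u'
      rw [← hxy i hmi.symm, hxi, hgu]
    · refine (Function.update_of_ne hmk.symm _ _).trans ?_
      change g (y.1 k) = w
      rw [← hxy k hmk.symm, hxk, hgz w hwu hwu' (Ne.symm hdw)]
    · by_cases hlm : l = m
      · rw [hlm]
        exact Function.update_self m (s.1 m) y'.1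
      · refine (Function.update_of_ne hlm _ _).trans ?_
        change g (y.1 l) = s.1 l
        have hlI : l ∉ I := by simp [I, h1, h2, h3, hlm]
        rw [← hxy l hlm, hx l h1 h2 h3]
        exact hgz _ (hM u hu l hlI) (hM u' hu' l hlI) (hM d hdM l hlI)
  exact ⟨u, u', huu', fun w hwu hwu' => ⟨key u hu u' hu' huu' w hwu hwu',
    key u' hu' u hu huu'.symm w hwu' hwu⟩⟩

/-- On an infinite type there is a permutation all of whose cycles have length three. -/
theorem exists_perm_three_cycles (α : Type u) [Infinite α] :
    ∃ σ : Equiv.Perm α, (∀ x, σ x ≠ x) ∧ ∀ x, σ (σ (σ x)) = x := by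
  have h : Cardinal.mk (α × ULift.{u} (ZMod 3)) = Cardinal.mk α := by
    rw [Cardinal.mk_prod, Cardinal.lift_id, Cardinal.lift_id]
    refine Cardinal.mul_eq_left (Cardinal.aleph0_le_mk α) ?_ ?_
    · exact (Cardinal.lt_aleph0_of_finite _).le.trans (Cardinal.aleph0_le_mk α)
    · exact Cardinal.mk_ne_zero _
  obtain ⟨f⟩ := Cardinal.eq.1 h
  let τ : Equiv.Perm (α × ULift.{u} (ZMod 3)) :=
    Equiv.prodCongr (Equiv.refl α) ((Equiv.ulift.trans (Equiv.addRight 1)).trans Equiv.ulift.symm)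
  refine ⟨f.permCongr τ, fun x hx => ?_, fun x => ?_⟩
  · have h1 : τ (f.symm x) = f.symm x := by
      rw [Equiv.permCongr_apply] at hx
      rw [← f.symm_apply_apply (τ (f.symm x)), hx]
    have h2 := congrArg (fun p => p.2.down) h1
    revert h2
    simp [τ]
  · simp only [Equiv.permCongr_apply, Equiv.symm_apply_apply]
    have h1 : τ (τ (τ (f.symm x))) = f.symm x := by
      refine Prod.ext rfl (ULift.ext _ _ ?_)
      change (f.symm x).2.down + 1 + 1 + 1 = (f.symm x).2.down
      rw [add_assoc, add_assoc]
      have : (1 + (1 + 1) : ZMod 3) = 0 := by decide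
      rw [this, add_zero]
    rw [h1, Equiv.apply_symm_apply]

/-- An even permutation that moves only the points of a cycle of `σ` of length three is a power of
that cycle, hence commutes with `σ`. -/
theorem commute_of_mem_evenPerm {σ g : Equiv.Perm ι} (hσ : ∀ x, σ x ≠ x)
    (hσ3 : ∀ x, σ (σ (σ x)) = x) (hg : g ∈ evenPerm ι) (i : ι)
    (hfix : ∀ l, l ≠ i → l ≠ σ i → l ≠ σ (σ i) → g l = l) (x : ι) : g (σ x) = σ (g x) := by
  classical
  have h01 : σ i ≠ i := hσ i
  have h12 : σ (σ i) ≠ σ i := hσ (σ i)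
  have h02 : σ (σ i) ≠ i := fun h => hσ i (by rw [← h, hσ3, h])
  have himg : ∀ l, (l = i ∨ l = σ i ∨ l = σ (σ i)) → (g l = i ∨ g l = σ i ∨ g l = σ (σ i)) := by
    intro l hl
    by_contra hne
    rw [not_or, not_or] at hne
    have h1 : g (g l) = g l := hfix _ hne.1 hne.2.1 hne.2.2
    rw [g.injective h1] at hne
    tauto
  have hswap : ∀ a b c, (∀ l, l ≠ a → l ≠ b → l ≠ c → g l = l) → a ≠ b → a ≠ c → b ≠ c →
      g a = b → g b = a → g c = c → False := by
    intro a b c hfix hab hac hbc ha hb hc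
    refine swap_notMem_evenPerm hab ?_
    convert! hg
    refine Equiv.ext fun l => ?_
    by_cases h1 : l = a
    · rw [h1, Equiv.swap_apply_left, ha]
    by_cases h2 : l = b
    · rw [h2, Equiv.swap_apply_right, hb]
    by_cases h3 : l = c
    · rw [h3, Equiv.swap_apply_of_ne_of_ne hac.symm hbc.symm, hc]
    rw [Equiv.swap_apply_of_ne_of_ne h1 h2, hfix l h1 h2 h3]
  have h0 := himg i (Or.inl rfl)
  have h1 := himg (σ i) (Or.inr (Or.inl rfl))
  have h2 := himg (σ (σ i)) (Or.inr (Or.inr rfl))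
  have hi01 : g i ≠ g (σ i) := fun h => h01 (g.injective h).symm
  have hi02 : g i ≠ g (σ (σ i)) := fun h => h02 (g.injective h).symm
  have hi12 : g (σ i) ≠ g (σ (σ i)) := fun h => h12 (g.injective h).symm
  have hs1 := hswap i (σ i) (σ (σ i)) hfix h01.symm h02.symm h12.symm
  have hs2 := hswap i (σ (σ i)) (σ i) (fun l h1 h2 h3 => hfix l h1 h3 h2) h02.symm h01.symm h12
  have hs3 := hswap (σ i) (σ (σ i)) i (fun l h1 h2 h3 => hfix l h3 h1 h2) h12.symm h01 h02
  have hcyc : (g i = i ∧ g (σ i) = σ i ∧ g (σ (σ i)) = σ (σ i)) ∨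
      (g i = σ i ∧ g (σ i) = σ (σ i) ∧ g (σ (σ i)) = i) ∨
      (g i = σ (σ i) ∧ g (σ i) = i ∧ g (σ (σ i)) = σ i) := by
    clear hswap himg hfix hg hσ
    grind
  by_cases hx : x = i ∨ x = σ i ∨ x = σ (σ i)
  · rcases hcyc with ⟨e0, e1, e2⟩ | ⟨e0, e1, e2⟩ | ⟨e0, e1, e2⟩ <;>
      rcases hx with rfl | rfl | rfl <;> simp only [e0, e1, e2, hσ3]
  · rw [not_or, not_or] at hx
    rw [hfix x hx.1 hx.2.1 hx.2.2, hfix]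
    · exact fun h => hx.2.2 (by rw [← h, hσ3])
    · exact fun h => hx.1 (σ.injective h)
    · exact fun h => hx.2.1 (σ.injective h)

/-- The relation `σ` between the coordinates `i` and `σ (σ i)` of those sequences that are the
identity except at `i`, `σ i`, `σ (σ i)`, spread over the orbits of the even permutations. -/
def cycleElement (σ : Equiv.Perm ι) (i : ι) : (evenAlgebra ι).carrier :=
  ⟨setAlgebraOf fun s => ∃ g ∈ evenPerm ι, (∀ l, l ≠ i → l ≠ σ i → l ≠ σ (σ i) → s.1 l = g l) ∧
      s.1 (σ (σ i)) = g (σ (g⁻¹ (s.1 i))), by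
    have key : ∀ s t : almostPerm ι, evenRel s t →
        (∃ g ∈ evenPerm ι, (∀ l, l ≠ i → l ≠ σ i → l ≠ σ (σ i) → s.1 l = g l) ∧
          s.1 (σ (σ i)) = g (σ (g⁻¹ (s.1 i)))) →
        ∃ g ∈ evenPerm ι, (∀ l, l ≠ i → l ≠ σ i → l ≠ σ (σ i) → t.1 l = g l) ∧
          t.1 (σ (σ i)) = g (σ (g⁻¹ (t.1 i))) := by
      rintro s t ⟨f, hf, hst⟩ ⟨g, hg, h1, h2⟩
      refine ⟨f * g, mul_mem hf hg, fun l a b c => ?_, ?_⟩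
      · rw [hst]
        exact congrArg f (h1 l a b c)
      · rw [hst, Function.comp, Function.comp, h2]
        simp
    exact fun s t h => ⟨key s t h, key t s (isBisimulation_evenRel.symm s t h)⟩⟩

/-- On `cycleElement σ i` the term `inseparable` speaks of the graph of `σ`, which separates any two
points. -/
theorem not_models_inseparable {σ : Equiv.Perm ι} (hσ : ∀ x, σ x ≠ x)
    (hσ3 : ∀ x, σ (σ (σ x)) = x) (i : ι) :
    ¬ Models (evenAlgebra ι) (⟨inseparable i (σ i) (σ (σ i)), .top⟩ : CEquation ι) := by
  classical
  intro h
  have h01 : i ≠ σ i := (hσ i).symm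
  have h12 : σ i ≠ σ (σ i) := (hσ (σ i)).symm
  have h02 : i ≠ σ (σ i) := fun h => hσ i ((congrArg σ h).trans (hσ3 i))
  let s : almostPerm ι := ⟨id, 1, by simp⟩
  have h1 : s ∈ toSet ((inseparable i (σ i) (σ (σ i))).eval (evenAlgebra ι)
      fun _ => cycleElement σ i) := by
    have := h fun _ => cycleElement σ i
    simp only [CTerm.eval_top] at this
    rw [this]
    trivial
  rw [CTerm.map_eval (isReductHom_toSet Set.univ) _ _ (Set.subset_univ _),
    mem_eval_inseparable updateClosed_almostPerm h01 h02 h12] at h1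
  obtain ⟨u, u', huu', hw⟩ := h1
  have key : ∀ u w, (∃ x ∈ toSet (cycleElement σ i), x.1 i = u ∧ x.1 (σ (σ i)) = w ∧
      ∀ l, l ≠ i → l ≠ σ i → l ≠ σ (σ i) → x.1 l = s.1 l) ↔ w = σ u := by
    intro u w
    constructor
    · rintro ⟨x, ⟨g, hg, hx1, hx2⟩, hxi, hxk, hx⟩
      have hcomm := commute_of_mem_evenPerm hσ hσ3 hg i
        fun l a b c => (hx1 l a b c).symm.trans (hx l a b c)
      rw [← hxk, hx2, hxi, hcomm]
      simp
    · rintro rfl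
      refine ⟨⟨_, updateClosed_almostPerm.update_mem
        ⟨_, updateClosed_almostPerm.update_mem s i u⟩ (σ (σ i)) (σ u)⟩,
        ⟨1, one_mem _, fun l a b c => ?_, ?_⟩, ?_, ?_, fun l a b c => ?_⟩
      · simp only [Function.update_of_ne c, Function.update_of_ne a]
        rfl
      · simp [Function.update_of_ne h02]
      · simp [Function.update_of_ne h02]
      · simp
      · simp only [Function.update_of_ne c, Function.update_of_ne a]
  simp only [key] at hw
  by_cases hu : σ u = u'
  · have h1 : σ u' ≠ u := fun h => by
      have e : σ (σ u) = u := by rw [hu, h]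
      exact hσ u ((congrArg σ e).symm.trans (hσ3 u))
    exact huu' (σ.injective ((hw (σ u') h1 (hσ u')).2 rfl).symm)
  · exact huu' (σ.injective ((hw (σ u) (hσ u) hu).1 rfl))

theorem ind_inseparable (i j k : ι) : (inseparable i j k).ind ⊆ {i, j, k} := by
  intro l
  simp only [inseparable, CTerm.ind, CTerm.inf, CTerm.symmDiff, Set.mem_union, Set.mem_insert_iff,
    Set.mem_singleton_iff, Set.mem_empty_iff_false]
  tauto

theorem evenAlgebra_notMem_Ret [Infinite ι] : evenAlgebra ι ∉ Ret ι := by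
  classical
  intro h
  obtain ⟨σ, hσ, hσ3⟩ := exists_perm_three_cycles ι
  obtain ⟨i⟩ : Nonempty ι := inferInstance
  obtain ⟨m, hm⟩ := Infinite.exists_notMem_finset {i, σ i, σ (σ i)}
  simp only [Finset.mem_insert, Finset.mem_singleton, not_or] at hm
  have h02 : i ≠ σ (σ i) := fun h => hσ i ((congrArg σ h).trans (hσ3 i))
  refine not_models_inseparable hσ hσ3 i (h.2 _ m ?_ (models_cylVars_inseparable (hσ i).symm h02
    (hσ (σ i)).symm hm.1 hm.2.1 hm.2.2))
  rintro (hl | hl)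
  · have := ind_inseparable _ _ _ hl
    simp only [Set.mem_insert_iff, Set.mem_singleton_iff] at this
    tauto
  · simp [CTerm.top, CTerm.ind] at hl

/-! ### Cartesian set algebras are endo-dc -/

/-- On an infinite type there is an injective self-map that fixes a given finite set pointwise and
misses a point outside it. -/
theorem exists_injective_fixing [Infinite ι] {Γ : Set ι} (hΓ : Γ.Finite) :
    ∃ (f : ι → ι) (κ : ι), Function.Injective f ∧ (∀ i ∈ Γ, f i = i) ∧ κ ∉ Γ ∧
      κ ∉ Set.range f := by
  classical
  have : Infinite {i // i ∉ Γ} := hΓ.infinite_compl.to_subtype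
  have h : Cardinal.mk (Option {i // i ∉ Γ}) = Cardinal.mk {i // i ∉ Γ} := by
    rw [Cardinal.mk_option, Cardinal.add_one_eq (Cardinal.aleph0_le_mk _)]
  obtain ⟨e⟩ := Cardinal.eq.1 h
  refine ⟨fun i => if hi : i ∈ Γ then i else (e (some ⟨i, hi⟩)).1, (e none).1, ?_,
    fun i hi => dif_pos hi, (e none).2, ?_⟩
  · intro i j hij
    by_cases hi : i ∈ Γ <;> by_cases hj : j ∈ Γ
    · simpa [hi, hj] using hij
    · simp only [hi, hj, dite_true, dite_false] at hij
      exact absurd (hij ▸ hi) (e (some ⟨j, hj⟩)).2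
    · simp only [hi, hj, dite_true, dite_false] at hij
      exact absurd (hij.symm ▸ hj) (e (some ⟨i, hi⟩)).2
    · simp only [hi, hj, dite_false] at hij
      simpa using e.injective (Subtype.ext hij)
  · rintro ⟨i, hi⟩
    by_cases hiΓ : i ∈ Γ
    · simp only [hiΓ, dite_true] at hi
      exact (e none).2 (hi ▸ hiΓ)
    · simp only [hiΓ, dite_false] at hi
      simpa using e.injective (Subtype.ext hi)

/-- The endomorphism required for `Γ` consists of the sequences `s` with `s ∘ f ∈ X`, where `f` is
an injective map of the indices that fixes `Γ` and misses `κ`. -/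
theorem cartesian_mem_Edc [Infinite ι] (U : Type u) : cartesian ι U ∈ Edc ι := by
  classical
  refine ⟨fullSetAlgebra_mem_CA updateClosed_univ, fun Γ hΓ X hX => ?_⟩
  obtain ⟨f, κ, hf, hfΓ, hκΓ, hκ⟩ := exists_injective_fixing hΓ
  let r : ↥(Set.univ : Set (ι → U)) → ↥(Set.univ : Set (ι → U)) := fun s => ⟨s.1 ∘ f, trivial⟩
  let h : (cartesian ι U).carrier → (cartesian ι U).carrier :=
    fun Y => setAlgebraOf fun s => r s ∈ Y
  refine ⟨κ, hκΓ, h, ⟨fun _ _ => rfl, fun _ => rfl, fun i hi Y => ?_, fun i hi j hj => ?_⟩, ?_,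
    fun Y => ?_⟩
  · refine SetLike.ext fun s => ?_
    rw [mem_fullSetAlgebra_c_iff_update updateClosed_univ]
    refine (mem_fullSetAlgebra_c_iff_update updateClosed_univ).trans (exists_congr fun u => ?_)
    have : (⟨Function.update (r s).1 i u, trivial⟩ : (Set.univ : Set (ι → U))) =
        r ⟨Function.update s.1 i u, trivial⟩ := by
      refine Subtype.ext ?_
      have := Function.update_comp_eq_of_injective s.1 hf i u
      rw [hfΓ i hi] at this
      exact this.symm
    rw [this]
    rfl
  · refine SetLike.ext fun s => ?_
    change s.1 (f i) = s.1 (f j) ↔ s.1 i = s.1 j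
    rw [hfΓ i hi, hfΓ j hj]
  · obtain ⟨s, hs⟩ := fullSetAlgebra_ne_bot_iff.1 hX
    have hU : Nonempty U := ⟨s.1 κ⟩
    refine fullSetAlgebra_ne_bot_iff.2
      ⟨⟨Function.extend f s.1 fun _ => Classical.arbitrary U, trivial⟩, ?_⟩
    refine mem_setAlgebraOf.2 ?_
    convert! hs
    exact Subtype.ext (funext fun i => hf.extend_apply s.1 (fun _ => Classical.arbitrary U) i)
  · refine SetLike.ext fun s => ?_
    rw [mem_fullSetAlgebra_c_iff_update updateClosed_univ]
    have key : ∀ u, r ⟨Function.update s.1 κ u, trivial⟩ = r s := fun u =>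
      Subtype.ext (Function.update_comp_eq_of_notMem_range s.1 u hκ)
    constructor
    · rintro ⟨u, hu⟩
      have hu' : r ⟨Function.update s.1 κ u, trivial⟩ ∈ Y := hu
      rw [key] at hu'
      exact hu'
    · intro hs
      refine ⟨s.1 κ, ?_⟩
      change r ⟨Function.update s.1 κ (s.1 κ), trivial⟩ ∈ Y
      rw [key]
      exact hs

/-! ### Algebras of term functions -/

/-- The functions on evaluations that are given by a term. -/
def termFunctions (A : CylStruct ι) : BooleanSubalgebra (power A (ℕ → A.carrier)).carrier where
  carrier := {f | ∃ t : CTerm ι, f = fun v => t.eval A v}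
  supClosed' := by
    rintro _ ⟨s, rfl⟩ _ ⟨t, rfl⟩
    exact ⟨s.add t, rfl⟩
  infClosed' := by
    rintro _ ⟨s, rfl⟩ _ ⟨t, rfl⟩
    exact ⟨s.inf t, funext fun v => (CTerm.eval_inf ..).symm⟩
  compl_mem' := by
    rintro _ ⟨s, rfl⟩
    exact ⟨s.neg, rfl⟩
  bot_mem' := ⟨CTerm.top.neg, funext fun v => by
    rw [CTerm.eval, CTerm.eval_top, compl_top]
    rfl⟩

/-- The algebra of the term functions of `A`: the countably generated free algebra of the variety
generated by `A`. -/
def termAlgebra (A : CylStruct ι) : CylStruct ι :=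
  restrict (power A (ℕ → A.carrier)) (termFunctions A)
    (by
      rintro i _ ⟨t, rfl⟩
      exact ⟨t.cyl i, rfl⟩)
    fun i j => ⟨.diag i j, rfl⟩

theorem eqTheory_termAlgebra (A : CylStruct ι) : EqTheory (termAlgebra A) = EqTheory A := by
  apply Set.Subset.antisymm
  · intro e he v
    have h1 := he fun n => ⟨fun v => v n, .var n, rfl⟩
    have h2 := congrFun (congrArg Subtype.val h1) v
    refine Eq.trans ?_ (h2.trans ?_)
    · refine Eq.symm ((congrFun (coe_eval_restrict _ e.lhs) v).trans ?_)
      exact eval_power _ _ _ _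
    · refine (congrFun (coe_eval_restrict _ e.rhs) v).trans ?_
      exact eval_power _ _ _ _
  · exact (eqTheory_subset_power _).trans eqTheory_subset_restrict

/-- There are no more term functions than terms. -/
theorem exists_injective_termAlgebra (A : CylStruct ι) :
    ∃ f : (termAlgebra A).carrier → CTerm ι, Function.Injective f := by
  choose f hf using fun x : (termAlgebra A).carrier => x.2
  exact ⟨f, fun x y h => Subtype.ext ((hf x).trans (by rw [h]; exact (hf y).symm))⟩

/-! ### An inductive algebra that is not endo-dc -/

open Classical in
/-- There is a coloring of the `ι`-termed sequences over a set, with more colors than any given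
bound, in which any color can be attained by changing a sequence at a given index to a new value.
The base is `W × W` for a large vector space `W`, and the color of a sequence is the sum of its
first projections, where summation is extended from finitely supported families to all of
`ι → W`. -/
theorem exists_coloring (ι Y : Type u) (hι : ∃ f : ι → Y, Function.Injective f) :
    ∃ (U W : Type u) (col : (ι → U) → W),
      (∀ t i w, ∃ x, x ∉ Set.range t ∧ col (Function.update t i x) = w) ∧
      (∃ s : ι → U, Function.Injective s) ∧ ∀ f : W → Y, ¬ Function.Injective f := by
  obtain ⟨e, he⟩ := hι
  let W : Type u := Y → ZMod 2
  -- By Cantor's theorem there are more colors than elements of `Y`.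
  have hW : ∀ f : W → Y, ¬ Function.Injective f := by
    intro f hf
    refine Function.cantor_injective (fun X : Set Y => f fun y => if y ∈ X then 1 else 0)
      fun X X' h => Set.ext fun y => ?_
    have := congrFun (hf h) y
    by_cases h1 : y ∈ X <;> by_cases h2 : y ∈ X' <;> simp_all
  obtain ⟨g, hg⟩ := LinearMap.exists_leftInverse_of_injective
    (Finsupp.lcoeFun : (ι →₀ W) →ₗ[ZMod 2] ι → W)
    (LinearMap.ker_eq_bot.2 DFunLike.coe_injective)
  let φ : (ι → W) →ₗ[ZMod 2] W := Finsupp.lsum (ZMod 2) (fun _ => LinearMap.id) ∘ₗ g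
  have hφ : ∀ i w, φ (Pi.single i w) = w := by
    intro i w
    have h := LinearMap.congr_fun hg (Finsupp.single i w)
    have h' : g (Pi.single i w) = Finsupp.single i w := by
      rw [← Finsupp.single_eq_pi_single]
      exact h
    simp only [φ, LinearMap.comp_apply, h']
    simp
  refine ⟨W × W, W, fun t => φ fun i => (t i).1, fun t i w => ?_,
    ⟨fun i => (fun y => if y = e i then 1 else 0, 0), fun i j h => ?_⟩, hW⟩
  · let w' : W := w - φ (Function.update (fun j => (t j).1) i 0)
    obtain ⟨z, hz⟩ : ∃ z, (w', z) ∉ Set.range t := by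
      by_contra! hz
      choose p hp using hz
      exact hW (e ∘ p) (he.comp fun z z' h => congrArg Prod.snd ((hp z).symm.trans
        ((congrArg t h).trans (hp z'))))
    refine ⟨(w', z), hz, ?_⟩
    have : (fun j => (Function.update t i (w', z) j).1) =
        Function.update (fun j => (t j).1) i 0 + Pi.single i w' := by
      funext j
      by_cases hj : j = i
      · subst hj
        simp
      · simp [hj]
    change φ _ = w
    rw [this, map_add, hφ]
    simp [w']
  · have := congrFun (congrArg Prod.fst h) (e i)
    by_contra hij
    simp [he.ne hij] at this

section Coloring

variable {U W : Type u} (col : (ι → U) → W)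

/-- Two sequences are related if they have the same coincidences between coordinates and, in case
they are injective, the same color. -/
def colorRel (s t : (Set.univ : Set (ι → U))) : Prop :=
  (∀ i j, s.1 i = s.1 j ↔ t.1 i = t.1 j) ∧ (Function.Injective s.1 → col s.1 = col t.1)

variable {col}

open Classical in
/-- Changes at one index of sequences of the same kernel can be matched, whatever their colors. -/
theorem exists_colorRel
    (hcol : ∀ t i w, ∃ x, x ∉ Set.range t ∧ col (Function.update t i x) = w)
    {s t : (Set.univ : Set (ι → U))} (hst : ∀ i j, s.1 i = s.1 j ↔ t.1 i = t.1 j) (i : ι)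
    (s' : (Set.univ : Set (ι → U))) (hs' : ∀ j, j ≠ i → s.1 j = s'.1 j) :
    ∃ t' : (Set.univ : Set (ι → U)), colorRel col s' t' ∧ ∀ j, j ≠ i → t.1 j = t'.1 j := by
  have hker : ∀ x : U, (∀ j, j ≠ i → (s'.1 i = s'.1 j ↔ x = t.1 j)) → ∀ j k,
      s'.1 j = s'.1 k ↔ Function.update t.1 i x j = Function.update t.1 i x k := by
    intro x hx j k
    by_cases hj : j = i <;> by_cases hk : k = i
    · simp [hj, hk]
    · rw [hj, Function.update_self, Function.update_of_ne hk]
      exact hx k hk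
    · rw [hk, Function.update_self, Function.update_of_ne hj, eq_comm, hx j hj, eq_comm]
    · rw [Function.update_of_ne hk, Function.update_of_ne hj, ← hs' j hj, ← hs' k hk]
      exact hst j k
  by_cases h : ∃ j, j ≠ i ∧ s'.1 i = s'.1 j
  · obtain ⟨j, hj, hij⟩ := h
    refine ⟨⟨Function.update t.1 i (t.1 j), trivial⟩, ⟨hker _ fun k hk => ?_, fun hinj => ?_⟩,
      fun k hk => (Function.update_of_ne hk _ _).symm⟩
    · rw [hij, ← hs' j hj, ← hs' k hk]
      exact hst j k
    · exact absurd (hinj hij).symm hj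
  · obtain ⟨x, hx, hxw⟩ := hcol t.1 i (col s'.1)
    exact ⟨⟨Function.update t.1 i x, trivial⟩, ⟨hker x fun k hk => ⟨fun h' => absurd ⟨k, hk, h'⟩ h,
      fun h' => absurd ⟨k, h'.symm⟩ hx⟩, fun _ => hxw.symm⟩,
      fun k hk => (Function.update_of_ne hk _ _).symm⟩

open Classical in
theorem isBisimulation_colorRel
    (hcol : ∀ t i w, ∃ x, x ∉ Set.range t ∧ col (Function.update t i x) = w) :
    IsBisimulation (colorRel col) where
  symm _ _ h := ⟨fun i j => (h.1 i j).symm, fun ht =>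
    (h.2 fun i j hij => ht ((h.1 i j).1 hij)).symm⟩
  zig _ _ h := exists_colorRel hcol h.1
  diag _ _ h i j := (h.1 i j).1

open Classical in
/-- Cylindrified elements are determined by the kernels of their members. -/
theorem exists_injOn_fixed {hE : IsBisimulation (colorRel col)}
    (hcol : ∀ t i w, ∃ x, x ∉ Set.range t ∧ col (Function.update t i x) = w) (κ : ι) :
    ∃ f : (invariantAlgebra hE).carrier → Set (Setoid ι),
      Set.InjOn f {x | (invariantAlgebra hE).c κ x = x} := by
  have key : ∀ x ∈ {x | (invariantAlgebra hE).c κ x = x}, ∀ s t : (Set.univ : Set (ι → U)),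
      Setoid.ker s.1 = Setoid.ker t.1 → s ∈ toSet x → t ∈ toSet x := by
    intro x hx s t hst hs
    have hc : (fullSetAlgebra Set.univ).c κ (toSet x) = toSet x := congrArg toSet hx
    rw [← hc] at hs ⊢
    obtain ⟨s', hs', h⟩ := hs
    obtain ⟨t', ht', h'⟩ := exists_colorRel hcol
      (fun i j => (Setoid.ext_iff.1 hst i j)) κ s' h
    exact ⟨t', (mem_toSet_iff x ht').1 hs', h'⟩
  have key' : ∀ x ∈ {x | (invariantAlgebra hE).c κ x = x},
      ∀ y ∈ {x | (invariantAlgebra hE).c κ x = x},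
      {r | ∃ s ∈ toSet x, Setoid.ker s.1 = r} = {r | ∃ s ∈ toSet y, Setoid.ker s.1 = r} →
      ∀ s, s ∈ toSet x → s ∈ toSet y := by
    intro x _ y hy h s hs
    obtain ⟨t, ht, hts⟩ := (Set.ext_iff.1 h (Setoid.ker s.1)).1 ⟨s, hs, rfl⟩
    exact key y hy t s hts ht
  refine ⟨fun x => {r | ∃ s ∈ toSet x, Setoid.ker s.1 = r}, fun x hx y hy h => ?_⟩
  exact toSet_injective (SetLike.ext fun s => ⟨key' x hx y hy h s, key' y hy x hx h.symm s⟩)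

end Coloring

/-- The element consisting of the injective sequences with color in `P`. -/
def colorElement {U W : Type u} {col : (ι → U) → W} (hE : IsBisimulation (colorRel col))
    (P : Set W) : (invariantAlgebra hE).carrier :=
  ⟨setAlgebraOf fun s => Function.Injective s.1 ∧ col s.1 ∈ P, by
    have key : ∀ s t, colorRel col s t → (Function.Injective s.1 ∧ col s.1 ∈ P) →
        Function.Injective t.1 ∧ col t.1 ∈ P := fun s t h ⟨h1, h2⟩ =>
      ⟨fun i j hij => h1 ((h.1 i j).2 hij), (h.2 h1).symm ▸ h2⟩
    exact fun s t h => ⟨key s t h, key t s (hE.symm s t h)⟩⟩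

/-- The example is the product of the algebra of sets invariant under a coloring with a small
algebra of the equational theory of the full set algebra. If `h` is an endomorphism of a reduct
containing `c i`, then, as the injective sequences of any one color have the same `c i`-closure, `h`
is nonzero on each color class if it is nonzero on the set of injective sequences. So its range is
large, but there are few elements of the form `c κ a`. -/
theorem exists_mem_Ret_notMem_Edc (ι : Type u) [Infinite ι] : ∃ C ∈ Ret ι, C ∉ Edc ι := by
  classical
  obtain ⟨U, W, col, hcol, ⟨s₀, hs₀⟩, hW⟩ := exists_coloring ι (Set (Setoid ι) × CTerm ι)
    ⟨fun i => (∅, .diag i i), fun i j h => by simpa using h⟩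
  have hE := isBisimulation_colorRel hcol
  have hC : prod (invariantAlgebra hE) (termAlgebra (cartesian ι U)) ∈ Ret ι := by
    refine mem_Ret_of_eqTheory_eq (Edc_subset_Ret (cartesian_mem_Edc U)) ?_
    rw [eqTheory_prod, eqTheory_termAlgebra]
    exact (Set.inter_eq_right.2 eqTheory_subset_restrict).symm
  refine ⟨_, hC, fun hEdc => ?_⟩
  obtain ⟨i⟩ : Nonempty ι := inferInstance
  let x : (prod (invariantAlgebra hE) (termAlgebra (cartesian ι U))).carrier :=
    (colorElement hE Set.univ, ⊥)
  let z : W → (prod (invariantAlgebra hE) (termAlgebra (cartesian ι U))).carrier :=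
    fun w => (colorElement hE {w}, ⊥)
  have hx : x ≠ ⊥ := by
    intro h
    have h1 : (⟨s₀, trivial⟩ : (Set.univ : Set (ι → U))) ∈ toSet x.1 := ⟨hs₀, trivial⟩
    rw [h] at h1
    exact h1
  obtain ⟨κ, -, h, hh, hhx, hκ⟩ := hEdc.2 {i} (Set.finite_singleton i) x hx
  have hxz : ∀ w, x ≤ (prod (invariantAlgebra hE) (termAlgebra (cartesian ι U))).c i (z w) := by
    refine fun w => ⟨?_, bot_le⟩
    rintro s ⟨hs, -⟩
    obtain ⟨y, hy, hyw⟩ := hcol s.1 i w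
    refine ⟨⟨Function.update s.1 i y, trivial⟩, ⟨?_, hyw⟩,
      fun j hj => (Function.update_of_ne hj _ _).symm⟩
    intro j k hjk
    by_cases hj : j = i <;> by_cases hk : k = i
    · rw [hj, hk]
    · simp only [hj, Function.update_self, Function.update_of_ne hk] at hjk
      exact absurd ⟨k, hjk.symm⟩ hy
    · simp only [hk, Function.update_self, Function.update_of_ne hj] at hjk
      exact absurd ⟨j, hjk⟩ hy
    · simp only [Function.update_of_ne hj, Function.update_of_ne hk] at hjk
      exact hs hjk
  have hz : ∀ w, h (z w) ≠ ⊥ := by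
    intro w hw
    have h1 := hh.mono (hxz w)
    rw [hh.map_c i rfl, hw, c_bot hC.1] at h1
    exact hhx (le_bot_iff.1 h1)
  have hdisj : ∀ w w', w ≠ w' → z w ⊓ z w' = ⊥ := by
    intro w w' hww'
    refine Prod.ext (toSet_injective (SetLike.ext fun s => ?_)) (bot_inf_eq _)
    constructor
    · rintro ⟨⟨-, h1⟩, ⟨-, h2⟩⟩
      exact absurd (Eq.trans (Eq.symm h1) h2) hww'
    · exact fun h => absurd h notMem_fullSetAlgebra_bot
  have hinj : Function.Injective fun w => h (z w) := by
    intro w w' hww'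
    by_contra hne
    have h1 := hh.map_inf (z w) (z w')
    rw [hdisj w w' hne, hh.map_bot] at h1
    have h2 : h (z w) = h (z w') := hww'
    rw [← h2, inf_idem] at h1
    exact hz w h1.symm
  obtain ⟨f, hf⟩ := exists_injOn_fixed (hE := hE) hcol κ
  obtain ⟨g, hg⟩ := exists_injective_termAlgebra (cartesian ι U)
  refine hW (fun w => (f (h (z w)).1, g (h (z w)).2)) fun w w' hww' => hinj ?_
  exact Prod.ext (hf (congrArg Prod.fst (hκ (z w))) (congrArg Prod.fst (hκ (z w')))
    (congrArg Prod.fst hww')) (hg (congrArg Prod.snd hww'))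

end CylAlg

/-- Endo-dc, inductive, and symmetric representable algebras of infinite dimension `ι`: the proper
inclusions between them, and the inductive algebras as those which are equationally
indistinguishable from a locally finite dimensional one. -/
theorem theorem4p8 (ι : Type u) [Infinite ι] :
    (CylAlg.Edc ι ⊂ CylAlg.Ret ι ∧ CylAlg.Ret ι ⊂ CylAlg.Sy ι ∩ CylAlg.RCA ι) ∧
    (∀ A ∈ CylAlg.CA ι,
      (A ∈ CylAlg.Ret ι ↔ ∃ B ∈ CylAlg.Lf ι, CylAlg.EqTheory A = CylAlg.EqTheory B)) := by
  refine ⟨⟨⟨CylAlg.Edc_subset_Ret, fun h => ?_⟩,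
    fun A hA => ⟨CylAlg.Ret_subset_Sy hA, CylAlg.Ret_subset_RCA hA⟩, fun h => ?_⟩,
    fun A hA => ⟨CylAlg.exists_Lf_eqTheory_eq, ?_⟩⟩
  · obtain ⟨C, hC, hC'⟩ := CylAlg.exists_mem_Ret_notMem_Edc ι
    exact hC' (h hC)
  · exact CylAlg.evenAlgebra_notMem_Ret
      (h ⟨CylAlg.evenAlgebra_mem_Sy, CylAlg.evenAlgebra_mem_RCA⟩)
  · rintro ⟨B, hB, h⟩
    exact CylAlg.mem_Ret_of_eqTheory_eq (CylAlg.Lf_subset_Ret hB) h.symm
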